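/- Let $\mathbb F$ be a field, $F\ge 1$ an integer and $\mathcal U$ a finite-dimensional $\mathbb F$-vector space. A linear coded caching scheme with $N=K=3$ and document size $F$ consists of subspaces $W_1,W_2,W_3$ (documents), $Z_1,Z_2,Z_3$ (caches) and $X_d$ for $d\in\{1,2,3\}^3$ (broadcasts) of $\mathcal U$ such that $W_1,W_2,W_3$ are linearly independent subspaces, each of dimension $F$, and $W_{d_j}\subset Z_j+X_d$ for all $j$ and $d$. It achieves $(M,R)\in\mathbb R^2$ if $\dim Z_j\le MF$ for all $j$ and $\dim X_d\le RF$ for all $d$. It is symmetric if for all permutations $\kappa,\nu$ of $\{1,2,3\}$ there is a linear automorphism $\iota$ of $\mathcal U$ with $\iota W_i=W_{\nu(i)}$, $\iota Z_j=Z_{\kappa(j)}$ and $\iota X_d=X_{\nu\circ d\circ\kappa^{-1}}$ for all $i,j,d$. For subspaces $A,B,C$ with isomorphisms $\nu\colon A\to B$ and $\nu'\colon A\to C$ (part of the data) write $A\oplus B=\{a+\nu(a): a\in A\}$ and $A\oplus B\oplus C=\{a+\nu(a)+\nu'(a): a\in A\}$. Real numbers $r_1,\dots,r_5$ are ratios of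 the scheme if for each $j$ there are linearly independent (possibly zero) subspaces $A_j^1,A_j^2,A_j^{\prime 3},A_j^{\prime\prime 3},A_j^4$ of $W_1$, and likewise subspaces $B_j^\bullet$ of $W_2$ and $C_j^\bullet$ of $W_3$, such that $Z_j$ is the sum of $A_j^1,B_j^1,C_j^1$ (individual part); $A_j^2\oplus B_j^2$ and $B_j^2\oplus C_j^2$ (Tian part); $A_j^{\prime3}\oplus B_j^{\prime3}$, $A_j^{\prime\prime3}\oplus C_j^{\prime3}$ and $B_j^{\prime\prime3}\oplus C_j^{\prime\prime3}$, where all these six spaces have the same dimension, independent of $j$ (two-way part); and $A_j^4\oplus B_j^4\oplus C_j^4$ (triple part); and such that, with $A_j^3=A_j^{\prime3}+A_j^{\prime\prime3}$ and similarly for $B$ and $C$, one has $\dim A_j^i=\dim B_j^i=\dim C_j^i=Fr_i$ for all $j$ and $1\le i\le4$, and $3Fr_5=F-\dim(A_1+A_2+A_3)$ where $A_j=A_j^1+A_j^2+A_j^3+A_j^4$. Then every linear coded caching scheme with $N=K=3$ that achieves $(M,R)$, symmetric or not, satisfies $$6M+5R\ge 11 .$$ A symmetric scheme has ratios whenever $Z_j\subset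 W_1+W_2+W_3$ for all $j$, and if a symmetric scheme achieves $(M,R)$ and has ratios $(r_1,\dots,r_5)$, then $$6M+5R\ge 11+\tfrac{15}{2}\,r_5 .$$ -/

import Mathlib

/-- An `𝕜`-linear coded caching scheme with `N` documents of size `F` and `K` users, given by
subspaces of an ambient vector space `U`: the documents `W i`, the caches `Z j`, and the
broadcasts `X d`, one for each demand vector `d` (user `j` requests document `d j`). -/
structure LinearCachingScheme (𝕜 U : Type*) [Field 𝕜] [AddCommGroup U] [Module 𝕜 U]
    (N K F : ℕ) where
  W : Fin N → Submodule 𝕜 U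
  Z : Fin K → Submodule 𝕜 U
  X : (Fin K → Fin N) → Submodule 𝕜 U
  indep : iSupIndep W
  finrank_W : ∀ i, Module.finrank 𝕜 (W i) = F
  decode : ∀ (j : Fin K) (d : Fin K → Fin N), W (d j) ≤ Z j ⊔ X d

/-- `A ⊕_ν B = {a + ν a | a ∈ A}` for an isomorphism `ν` of subspaces `A → B`. -/
def twoWaySum {𝕜 U : Type*} [Field 𝕜] [AddCommGroup U] [Module 𝕜 U]
    {A B : Submodule 𝕜 U} (e : A ≃ₗ[𝕜] B) : Submodule 𝕜 U :=
  LinearMap.range (A.subtype + B.subtype ∘ₗ e.toLinearMap)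

/-- `{a + ν₁ a + ν₂ a | a ∈ A}` for isomorphisms `ν₁ : A → B` and `ν₂ : A → C`. -/
def threeWaySum {𝕜 U : Type*} [Field 𝕜] [AddCommGroup U] [Module 𝕜 U]
    {A B C : Submodule 𝕜 U} (e : A ≃ₗ[𝕜] B) (f : A ≃ₗ[𝕜] C) : Submodule 𝕜 U :=
  LinearMap.range (A.subtype + B.subtype ∘ₗ e.toLinearMap + C.subtype ∘ₗ f.toLinearMap)

/-- A decomposition of a cache `Z` relative to documents `W 0, W 1, W 2` into
a pure individual scheme, a pure Tian scheme, `AB`-, `AC`- and `BC`-schemes, and a triple scheme.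
`P 0 k`, `P 1 k`, `P 2 k` are the parts (`A`, `B`, `C`) contained in `W 0`, `W 1`, `W 2`:
`k = 0` for the individual part, `k = 1` for the Tian part, `k = 2` and `k = 3` for the
once-primed and twice-primed two-way parts (`A'` pairs with `B'`, `A''` with `C'`,
`B''` with `C''`), and `k = 4` for the triple part. -/
structure CacheDecomposition {𝕜 U : Type*} [Field 𝕜] [AddCommGroup U] [Module 𝕜 U]
    (W : Fin 3 → Submodule 𝕜 U) (Z : Submodule 𝕜 U) where
  P : Fin 3 → Fin 5 → Submodule 𝕜 U
  le_W : ∀ i k, P i k ≤ W i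
  indep : ∀ i, iSupIndep (P i)
  tianAB : P 0 1 ≃ₗ[𝕜] P 1 1
  tianBC : P 1 1 ≃ₗ[𝕜] P 2 1
  pairAB : P 0 2 ≃ₗ[𝕜] P 1 2
  pairAC : P 0 3 ≃ₗ[𝕜] P 2 2
  pairBC : P 1 3 ≃ₗ[𝕜] P 2 3
  tripleAB : P 0 4 ≃ₗ[𝕜] P 1 4
  tripleAC : P 0 4 ≃ₗ[𝕜] P 2 4
  eq_sup : Z = (P 0 0 ⊔ P 1 0 ⊔ P 2 0) ⊔ (twoWaySum tianAB ⊔ twoWaySum tianBC) ⊔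
    (twoWaySum pairAB ⊔ twoWaySum pairAC ⊔ twoWaySum pairBC) ⊔ threeWaySum tripleAB tripleAC

namespace LinearCachingScheme

variable {𝕜 U : Type*} [Field 𝕜] [AddCommGroup U] [Module 𝕜 U] {N K F : ℕ}

/-- The scheme achieves the memory-rate pair `(M, R)`. -/
def Achieves (S : LinearCachingScheme 𝕜 U N K F) (M R : ℝ) : Prop :=
  (∀ j, (Module.finrank 𝕜 (S.Z j) : ℝ) ≤ M * F) ∧
    ∀ d, (Module.finrank 𝕜 (S.X d) : ℝ) ≤ R * F

/-- The scheme is symmetric: every permutation `κ` of the users and `ν` of the documents is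
induced by a linear automorphism of the ambient space. After relabelling, user `κ j` requests
the document `ν (d j)`, so `X d` is sent to the broadcast of the demand `ν ∘ d ∘ κ⁻¹`. -/
def IsSymmetric (S : LinearCachingScheme 𝕜 U N K F) : Prop :=
  ∀ (κ : Equiv.Perm (Fin K)) (ν : Equiv.Perm (Fin N)), ∃ ι : U ≃ₗ[𝕜] U,
    (∀ i, (S.W i).map ι.toLinearMap = S.W (ν i)) ∧
    (∀ j, (S.Z j).map ι.toLinearMap = S.Z (κ j)) ∧
    ∀ d, (S.X d).map ι.toLinearMap = S.X (fun j => ν (d (κ.symm j)))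

/-- `(r₁, r₂, r₃, r₄, r₅)` are the ratios of a scheme with three documents and three users:
`F rᵢ` is the dimension of the individual (`i = 1`), Tian (`i = 2`), two-way (`i = 3`, the sum
of the once-primed and the twice-primed part) and triple (`i = 4`) part in each document, for
each cache, and `3 F r₅` is the dimension of the part of the first document that is unused by
the caches. -/
def HasRatios (S : LinearCachingScheme 𝕜 U 3 3 F) (r₁ r₂ r₃ r₄ r₅ : ℝ) : Prop :=
  ∃ D : ∀ j, CacheDecomposition S.W (S.Z j),
    (∀ j i, (F : ℝ) * r₁ = Module.finrank 𝕜 ((D j).P i 0)) ∧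
    (∀ j i, (F : ℝ) * r₂ = Module.finrank 𝕜 ((D j).P i 1)) ∧
    (∃ t : ℕ, ∀ j i, Module.finrank 𝕜 ((D j).P i 2) = t ∧ Module.finrank 𝕜 ((D j).P i 3) = t) ∧
    (∀ j i, (F : ℝ) * r₃ = Module.finrank 𝕜 ((D j).P i 2 ⊔ (D j).P i 3 : Submodule 𝕜 U)) ∧
    (∀ j i, (F : ℝ) * r₄ = Module.finrank 𝕜 ((D j).P i 4)) ∧
    3 * (F : ℝ) * r₅ = F - Module.finrank 𝕜 (⨆ j, ⨆ k, (D j).P 0 k : Submodule 𝕜 U)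

end LinearCachingScheme

/-! The bound comes from the six demands in which the three users request different documents;
summing over all of them takes the place of symmetry. A broadcast `X` of this kind is bounded in two
ways. With the caches of two users it spans two documents (`rk_le_of_two_users`). It also contains
the three subspaces `X ⊓ (W i ⊔ Z j)`, with user `j` requesting `W i`, and inclusion-exclusion
inside `X` loses only their common part, which lies in a space `J` (`rk_le_of_three_users`).
`rk_broadcast_ge` mixes the two bounds.

It remains to bound the six spaces `J` from above. Modulo two documents, each `J` is shared by two
caches, so all of them lie in one space `N`, whose dimension is controlled by the two-user sums
already counted (`rk_shared_le`, `rk_meet_document_le`). Everything then cancels except `22 ∑ dim W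
≤ 5 ∑ dim X + 12 ∑ dim Z` (`rk_documents_le_of_full`).

That inequality assumes that the caches use the documents fully, but allows arbitrary dimensions. It
is applied to the used parts of the documents; every broadcast has to carry the unused parts in
full, which yields the term in `r₅`. Projecting onto the sum of the documents reduces an arbitrary
scheme to one with caches in that sum.

Ratios exist because a cache splits along successive complements among the spaces `Z ⊓ (W i ⊔ W j)`
and `Z ⊓ W i` (`exists_cacheDecomposition`), and the resulting dimensions are invariant under the
automorphisms of a symmetric scheme. -/

namespace Submodule

/-! ### Dimension inequalities for sums and intersections of subspaces. -/

variable {𝕜 U : Type*} [Field 𝕜] [AddCommGroup U] [Module 𝕜 U]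

/-- The dimension of a subspace as a real number. -/
noncomputable def rk (p : Submodule 𝕜 U) : ℝ := Module.finrank 𝕜 p

theorem rk_nonneg (p : Submodule 𝕜 U) : 0 ≤ rk p := by
  unfold rk
  positivity

theorem rk_bot : rk (⊥ : Submodule 𝕜 U) = 0 := by
  unfold rk
  simp

/-- The sum of the pairwise intersections of three subspaces. -/
def overlap (V₁ V₂ V₃ : Submodule 𝕜 U) : Submodule 𝕜 U := V₁ ⊓ V₂ ⊔ V₁ ⊓ V₃ ⊔ V₂ ⊓ V₃

theorem le_overlap {H V₁ V₂ : Submodule 𝕜 U} (V₃ : Submodule 𝕜 U) (h₁ : H ≤ V₁) (h₂ : H ≤ V₂) :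
    H ≤ overlap V₁ V₂ V₃ :=
  (le_inf h₁ h₂).trans (le_sup_left.trans le_sup_left)

/-- The part of the space that, modulo the complement `H` of a document, is shared by two caches. -/
def shared (H Z₁ Z₂ Z₃ : Submodule 𝕜 U) : Submodule 𝕜 U := overlap (H ⊔ Z₁) (H ⊔ Z₂) (H ⊔ Z₃)

theorem le_shared (H Z₁ Z₂ Z₃ : Submodule 𝕜 U) : H ≤ shared H Z₁ Z₂ Z₃ :=
  le_overlap _ le_sup_left le_sup_left

variable [FiniteDimensional 𝕜 U]

theorem rk_sup_add_rk_inf (p q : Submodule 𝕜 U) : rk (p ⊔ q) + rk (p ⊓ q) = rk p + rk q := by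
  unfold rk
  exact_mod_cast finrank_sup_add_finrank_inf_eq p q

theorem rk_mono {p q : Submodule 𝕜 U} (h : p ≤ q) : rk p ≤ rk q := by
  unfold rk
  exact_mod_cast finrank_mono h

theorem rk_sup_of_disjoint {p q : Submodule 𝕜 U} (h : Disjoint p q) :
    rk (p ⊔ q) = rk p + rk q := by
  rw [← rk_sup_add_rk_inf, h.eq_bot, rk_bot, add_zero]

/-- Two users with different demands: the broadcast together with both caches determines both
documents, and the dimension of `Z₁ ⊓ (B ⊔ Z₂)` is lost. -/
theorem rk_le_of_two_users {A B Z₁ Z₂ X : Submodule 𝕜 U} (hA : A ≤ Z₁ ⊔ X) (hB : B ≤ Z₂ ⊔ X) :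
    rk ((A ⊔ B) ⊔ (Z₁ ⊔ Z₂)) + rk ((B ⊔ Z₁) ⊓ (B ⊔ Z₂)) + rk (B ⊓ Z₁) ≤
      rk X + rk Z₁ + rk Z₂ + rk B := by
  have h1 := rk_sup_add_rk_inf Z₁ (Z₂ ⊔ X)
  have h2 := rk_sup_add_rk_inf Z₂ X
  have h3 : rk ((A ⊔ B) ⊔ (Z₁ ⊔ Z₂)) ≤ rk (Z₁ ⊔ (Z₂ ⊔ X)) := by
    refine rk_mono (sup_le (sup_le (hA.trans ?_) (hB.trans ?_)) (sup_le ?_ ?_))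
    · exact sup_le_sup_left le_sup_right _
    · exact le_sup_right
    · exact le_sup_left
    · exact le_sup_left.trans le_sup_right
  have h4 : rk (Z₁ ⊓ (B ⊔ Z₂)) ≤ rk (Z₁ ⊓ (Z₂ ⊔ X)) :=
    rk_mono (inf_le_inf_left _ (sup_le hB le_sup_left))
  -- These identities give `rk (Z₁ ⊓ (B ⊔ Z₂)) = rk ((B ⊔ Z₁) ⊓ (B ⊔ Z₂)) - rk B + rk (B ⊓ Z₁)`.
  have h5 := rk_sup_add_rk_inf Z₁ (B ⊔ Z₂)
  have h6 := rk_sup_add_rk_inf (B ⊔ Z₁) (B ⊔ Z₂)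
  have h7 := rk_sup_add_rk_inf B Z₁
  have h8 : (B ⊔ Z₁) ⊔ (B ⊔ Z₂) = Z₁ ⊔ (B ⊔ Z₂) := by
    rw [sup_comm B Z₁, sup_assoc, ← sup_assoc B B, sup_idem]
  have h9 := rk_nonneg (Z₂ ⊓ X)
  rw [h8] at h6
  linarith

/-- Three subspaces of a space `X`. -/
theorem rk_le_of_three_le {Y₁ Y₂ Y₃ X : Submodule 𝕜 U} (h₁ : Y₁ ≤ X) (h₂ : Y₂ ≤ X)
    (h₃ : Y₃ ≤ X) : rk Y₁ + rk Y₂ + rk Y₃ ≤ 2 * rk X + rk (Y₁ ⊓ Y₂ ⊓ Y₃) := by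
  have h4 := rk_sup_add_rk_inf Y₁ Y₂
  have h5 := rk_sup_add_rk_inf Y₁ Y₃
  have h6 := rk_sup_add_rk_inf (Y₁ ⊓ Y₂) (Y₁ ⊓ Y₃)
  have h7 : (Y₁ ⊓ Y₂) ⊓ (Y₁ ⊓ Y₃) = Y₁ ⊓ Y₂ ⊓ Y₃ := by
    rw [inf_inf_distrib_left Y₁ Y₂ Y₃ |>.symm, inf_assoc]
  have h8 : rk ((Y₁ ⊓ Y₂) ⊔ (Y₁ ⊓ Y₃)) ≤ rk Y₁ := rk_mono (sup_le inf_le_left inf_le_left)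
  have h9 : rk (Y₁ ⊔ Y₂) ≤ rk X := rk_mono (sup_le h₁ h₂)
  have h10 : rk (Y₁ ⊔ Y₃) ≤ rk X := rk_mono (sup_le h₁ h₃)
  rw [h7] at h6
  linarith

/-- Adding `A` to `Z ⊔ X` gains nothing, so `X` itself must supply the dimensions of `A` missing
from `Z`. -/
theorem rk_sub_le_rk_inf {A Z X : Submodule 𝕜 U} (hA : A ≤ Z ⊔ X) :
    rk A - rk (A ⊓ Z) ≤ rk (X ⊓ (A ⊔ Z)) := by
  have h1 := rk_sup_add_rk_inf X (A ⊔ Z)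
  have h2 := rk_sup_add_rk_inf A Z
  have h3 := rk_sup_add_rk_inf Z X
  have h4 : rk (X ⊔ (A ⊔ Z)) ≤ rk (Z ⊔ X) :=
    rk_mono (sup_le le_sup_right (sup_le hA le_sup_left))
  have h5 := rk_nonneg (Z ⊓ X)
  linarith

theorem rk_le_of_three_users {A B C Z₁ Z₂ Z₃ X J : Submodule 𝕜 U}
    (hA : A ≤ Z₁ ⊔ X) (hB : B ≤ Z₂ ⊔ X) (hC : C ≤ Z₃ ⊔ X)
    (hJ : (A ⊔ Z₁) ⊓ (B ⊔ Z₂) ⊓ (C ⊔ Z₃) ≤ J) :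
    rk A + rk B + rk C ≤ 2 * rk X + rk J + rk (A ⊓ Z₁) + rk (B ⊓ Z₂) + rk (C ⊓ Z₃) := by
  have h1 := rk_sub_le_rk_inf hA
  have h2 := rk_sub_le_rk_inf hB
  have h3 := rk_sub_le_rk_inf hC
  have h4 := rk_le_of_three_le (inf_le_left : X ⊓ (A ⊔ Z₁) ≤ X) (inf_le_left : X ⊓ (B ⊔ Z₂) ≤ X)
    (inf_le_left : X ⊓ (C ⊔ Z₃) ≤ X)
  have h5 : rk ((X ⊓ (A ⊔ Z₁)) ⊓ (X ⊓ (B ⊔ Z₂)) ⊓ (X ⊓ (C ⊔ Z₃))) ≤ rk J :=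
    rk_mono ((inf_le_inf (inf_le_inf inf_le_right inf_le_right) inf_le_right).trans hJ)
  linarith

/-- The bound on a broadcast from a demand in which all documents are requested. -/
theorem rk_broadcast_ge {A B C Z₁ Z₂ Z₃ X J : Submodule 𝕜 U}
    (hA : A ≤ Z₁ ⊔ X) (hB : B ≤ Z₂ ⊔ X) (hC : C ≤ Z₃ ⊔ X)
    (hJ : (A ⊔ Z₁) ⊓ (B ⊔ Z₂) ⊓ (C ⊔ Z₃) ≤ J) :
    2 * (rk ((A ⊔ B) ⊔ (Z₁ ⊔ Z₂)) + rk ((A ⊔ C) ⊔ (Z₁ ⊔ Z₃)) + rk ((B ⊔ C) ⊔ (Z₂ ⊔ Z₃))) +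
      (rk ((A ⊔ Z₁) ⊓ (A ⊔ Z₂)) + rk ((A ⊔ Z₁) ⊓ (A ⊔ Z₃)) + rk ((B ⊔ Z₁) ⊓ (B ⊔ Z₂)) +
        rk ((B ⊔ Z₂) ⊓ (B ⊔ Z₃)) + rk ((C ⊔ Z₁) ⊓ (C ⊔ Z₃)) + rk ((C ⊔ Z₂) ⊓ (C ⊔ Z₃))) +
      (rk (A ⊓ Z₂) + rk (A ⊓ Z₃) + rk (B ⊓ Z₁) + rk (B ⊓ Z₃) + rk (C ⊓ Z₁) + rk (C ⊓ Z₂)) ≤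
    10 * rk X + 2 * rk J + 4 * (rk Z₁ + rk Z₂ + rk Z₃) +
      2 * (rk (A ⊓ Z₁) + rk (B ⊓ Z₂) + rk (C ⊓ Z₃)) := by
  -- All six ordered pairs of users enter with weight 1 and the three-user bound with weight 2, so
  -- that `rk A`, `rk B`, `rk C` cancel.
  have h1 := rk_le_of_two_users hA hB
  have h2 := rk_le_of_two_users hA hC
  have h3 := rk_le_of_two_users hB hC
  have h4 := rk_le_of_two_users hB hA
  have h5 := rk_le_of_two_users hC hA
  have h6 := rk_le_of_two_users hC hB
  have h7 := rk_le_of_three_users hA hB hC hJ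
  rw [sup_comm B A, sup_comm Z₂ Z₁, inf_comm (A ⊔ Z₂)] at h4
  rw [sup_comm C A, sup_comm Z₃ Z₁, inf_comm (A ⊔ Z₃)] at h5
  rw [sup_comm C B, sup_comm Z₃ Z₂, inf_comm (B ⊔ Z₃)] at h6
  linarith

/-- The analogue for finite sets is an equality: a point in exactly one set counts twice on both
sides, any other point of the union three times. For subspaces only `V₁ ⊓ V₃ ⊔ V₂ ⊓ V₃ ≤ (V₁ ⊔ V₂) ⊓
V₃` holds, hence the inequality. -/
theorem rk_overlap_le (V₁ V₂ V₃ : Submodule 𝕜 U) :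
    rk (overlap V₁ V₂ V₃) + 2 * rk (V₁ ⊔ V₂ ⊔ V₃) ≤
      rk (V₁ ⊔ V₂) + rk (V₁ ⊔ V₃) + rk (V₂ ⊔ V₃) := by
  have h12 := rk_sup_add_rk_inf V₁ V₂
  have h13 := rk_sup_add_rk_inf V₁ V₃
  have h23 := rk_sup_add_rk_inf V₂ V₃
  have h1 := rk_sup_add_rk_inf (V₁ ⊔ V₂) V₃
  have h2 := rk_sup_add_rk_inf (V₁ ⊓ V₃) (V₂ ⊓ V₃)
  have h3 : rk (V₁ ⊓ V₃ ⊔ V₂ ⊓ V₃) ≤ rk ((V₁ ⊔ V₂) ⊓ V₃) :=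
    rk_mono (sup_le (inf_le_inf_right _ le_sup_left) (inf_le_inf_right _ le_sup_right))
  have h4 := rk_sup_add_rk_inf (V₁ ⊓ V₂) (V₁ ⊓ V₃ ⊔ V₂ ⊓ V₃)
  have h5 : rk ((V₁ ⊓ V₃) ⊓ (V₂ ⊓ V₃)) ≤ rk ((V₁ ⊓ V₂) ⊓ (V₁ ⊓ V₃ ⊔ V₂ ⊓ V₃)) :=
    rk_mono (le_inf (inf_le_inf inf_le_left inf_le_left) (inf_le_left.trans le_sup_left))
  rw [← sup_assoc] at h4
  unfold overlap
  linarith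

theorem rk_shared_le {H S : Submodule 𝕜 U} (Z₁ Z₂ Z₃ : Submodule 𝕜 U)
    (hS : S ≤ H ⊔ Z₁ ⊔ Z₂ ⊔ Z₃) :
    rk (shared H Z₁ Z₂ Z₃) + 2 * rk S ≤
      rk (H ⊔ (Z₁ ⊔ Z₂)) + rk (H ⊔ (Z₁ ⊔ Z₃)) + rk (H ⊔ (Z₂ ⊔ Z₃)) := by
  have h := rk_overlap_le (H ⊔ Z₁) (H ⊔ Z₂) (H ⊔ Z₃)
  have h1 : rk S ≤ rk ((H ⊔ Z₁) ⊔ (H ⊔ Z₂) ⊔ (H ⊔ Z₃)) := by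
    rw [← sup_sup_distrib_left, ← sup_sup_distrib_left, ← sup_assoc, ← sup_assoc]
    exact rk_mono hS
  rw [← sup_sup_distrib_left H Z₁ Z₂, ← sup_sup_distrib_left H Z₁ Z₃,
    ← sup_sup_distrib_left H Z₂ Z₃] at h
  rw [← sup_sup_distrib_left H Z₁ Z₂] at h1
  unfold shared
  linarith

theorem rk_inf_three_le {S α β γ : Submodule 𝕜 U} (h₁ : S ≤ α ⊔ β ⊓ γ) (h₂ : S ≤ β ⊔ γ) :
    rk (α ⊓ (β ⊓ γ)) + 2 * rk S ≤ rk α + rk β + rk γ := by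
  have h3 := rk_sup_add_rk_inf α (β ⊓ γ)
  have h4 := rk_sup_add_rk_inf β γ
  have h5 := rk_mono h₁
  have h6 := rk_mono h₂
  linarith

/-- The two spaces on the left lie in `N` and meet inside `(A ⊔ Z₁) ⊓ (A ⊔ Z₂) ⊓ α`. This
intersection is small because `A ≤ (A ⊔ Z₁) ⊓ (A ⊔ Z₂)` already spans `S` together with `α`. -/
theorem rk_inf_pair_le {A Z₁ Z₂ N α S : Submodule 𝕜 U} (hN : N ≤ α) (hS : S ≤ A ⊔ α) :
    rk ((A ⊔ Z₁) ⊓ N) + rk ((A ⊔ Z₂) ⊓ N) + rk S ≤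
      rk N + rk ((A ⊔ Z₁) ⊓ (A ⊔ Z₂)) + rk α := by
  have h1 := rk_sup_add_rk_inf ((A ⊔ Z₁) ⊓ N) ((A ⊔ Z₂) ⊓ N)
  have h2 : rk ((A ⊔ Z₁) ⊓ N ⊔ (A ⊔ Z₂) ⊓ N) ≤ rk N := rk_mono (sup_le inf_le_right inf_le_right)
  have h3 : rk (((A ⊔ Z₁) ⊓ N) ⊓ ((A ⊔ Z₂) ⊓ N)) ≤ rk (((A ⊔ Z₁) ⊓ (A ⊔ Z₂)) ⊓ α) :=
    rk_mono (le_inf (inf_le_inf inf_le_left inf_le_left) (inf_le_left.trans (inf_le_right.trans hN)))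
  have h4 := rk_sup_add_rk_inf ((A ⊔ Z₁) ⊓ (A ⊔ Z₂)) α
  have h5 : rk S ≤ rk (((A ⊔ Z₁) ⊓ (A ⊔ Z₂)) ⊔ α) :=
    rk_mono (hS.trans (sup_le_sup_right (le_inf le_sup_left le_sup_left) _))
  linarith

/-- `J` and `J'` belong to demands that differ by exchanging `B` and `C` between two users. Their
intersection lies in both meets on the right, and these meets contain `B` and `C`, so their sum has
dimension at least `rk B + rk C`. -/
theorem rk_add_le_of_inf_le {J J' B C Z₂ Z₃ G : Submodule 𝕜 U} (hBC : Disjoint B C) (hJ : J ≤ G)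
    (hJ' : J' ≤ G) (hJB : J ≤ B ⊔ Z₂) (hJC : J ≤ C ⊔ Z₃) (hJB' : J' ≤ B ⊔ Z₃)
    (hJC' : J' ≤ C ⊔ Z₂) :
    rk J + rk J' + rk B + rk C ≤
      rk G + rk ((B ⊔ Z₂) ⊓ (B ⊔ Z₃)) + rk ((C ⊔ Z₂) ⊓ (C ⊔ Z₃)) := by
  have h1 := rk_sup_add_rk_inf J J'
  have h2 : rk (J ⊔ J') ≤ rk G := rk_mono (sup_le hJ hJ')
  have h3 := rk_sup_add_rk_inf ((B ⊔ Z₂) ⊓ (B ⊔ Z₃)) ((C ⊔ Z₂) ⊓ (C ⊔ Z₃))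
  have h4 : rk (J ⊓ J') ≤ rk (((B ⊔ Z₂) ⊓ (B ⊔ Z₃)) ⊓ ((C ⊔ Z₂) ⊓ (C ⊔ Z₃))) :=
    rk_mono (le_inf (le_inf (inf_le_left.trans hJB) (inf_le_right.trans hJB'))
      (le_inf (inf_le_right.trans hJC') (inf_le_left.trans hJC)))
  have h5 : rk (B ⊔ C) ≤ rk (((B ⊔ Z₂) ⊓ (B ⊔ Z₃)) ⊔ ((C ⊔ Z₂) ⊓ (C ⊔ Z₃))) :=
    rk_mono (sup_le_sup (le_inf le_sup_left le_sup_left) (le_inf le_sup_left le_sup_left))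
  rw [rk_sup_of_disjoint hBC] at h5
  linarith

end Submodule

/-! ### Three documents that are fully used by the caches. -/

namespace Submodule

variable {𝕜 U : Type*} [Field 𝕜] [AddCommGroup U] [Module 𝕜 U]

/-- Enlarging both `B` and `C` to `B ⊔ C` turns the meet for two different caches into one of the
three summands of `shared`. -/
theorem inf_three_le_shared {Q B C Z₁ Z₂ Z₃ P : Submodule 𝕜 U}
    (h : P = (B ⊔ Z₁) ⊓ (C ⊔ Z₂) ∨ P = (B ⊔ Z₂) ⊓ (C ⊔ Z₁) ∨
      P = (B ⊔ Z₁) ⊓ (C ⊔ Z₃) ∨ P = (B ⊔ Z₃) ⊓ (C ⊔ Z₁) ∨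
      P = (B ⊔ Z₂) ⊓ (C ⊔ Z₃) ∨ P = (B ⊔ Z₃) ⊓ (C ⊔ Z₂)) (hQ : Q ≤ P) :
    Q ≤ shared (B ⊔ C) Z₁ Z₂ Z₃ := by
  refine hQ.trans ?_
  have hB : ∀ Z : Submodule 𝕜 U, B ⊔ Z ≤ B ⊔ C ⊔ Z := fun Z => sup_le_sup_right le_sup_left _
  have hC : ∀ Z : Submodule 𝕜 U, C ⊔ Z ≤ B ⊔ C ⊔ Z := fun Z => sup_le_sup_right le_sup_right _
  unfold shared overlap
  rcases h with rfl | rfl | rfl | rfl | rfl | rfl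
  · exact (inf_le_inf (hB _) (hC _)).trans (le_sup_left.trans le_sup_left)
  · exact (inf_comm _ _).le.trans
      ((inf_le_inf (hC _) (hB _)).trans (le_sup_left.trans le_sup_left))
  · exact (inf_le_inf (hB _) (hC _)).trans (le_sup_right.trans le_sup_left)
  · exact (inf_comm _ _).le.trans
      ((inf_le_inf (hC _) (hB _)).trans (le_sup_right.trans le_sup_left))
  · exact (inf_le_inf (hB _) (hC _)).trans le_sup_right
  · exact (inf_comm _ _).le.trans ((inf_le_inf (hC _) (hB _)).trans le_sup_right)

variable [FiniteDimensional 𝕜 U]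

/-- The bounds that a single document `A`, with the other two documents `B` and `C`, contributes:
`J j k l` is the space `(A ⊔ Z j) ⊓ (B ⊔ Z k) ⊓ (C ⊔ Z l)`. -/
theorem rk_meet_document_le {A B C Z₁ Z₂ Z₃ N J₁₂₃ J₁₃₂ J₂₁₃ J₂₃₁ J₃₁₂ J₃₂₁ : Submodule 𝕜 U}
    (hBC : Disjoint B C) (hN : N ≤ shared (B ⊔ C) Z₁ Z₂ Z₃)
    (h₁ : J₁₂₃ ≤ N ⊓ ((A ⊔ Z₁) ⊓ (B ⊔ Z₂) ⊓ (C ⊔ Z₃)))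
    (h₂ : J₁₃₂ ≤ N ⊓ ((A ⊔ Z₁) ⊓ (B ⊔ Z₃) ⊓ (C ⊔ Z₂)))
    (h₃ : J₂₁₃ ≤ N ⊓ ((A ⊔ Z₂) ⊓ (B ⊔ Z₁) ⊓ (C ⊔ Z₃)))
    (h₄ : J₂₃₁ ≤ N ⊓ ((A ⊔ Z₂) ⊓ (B ⊔ Z₃) ⊓ (C ⊔ Z₁)))
    (h₅ : J₃₁₂ ≤ N ⊓ ((A ⊔ Z₃) ⊓ (B ⊔ Z₁) ⊓ (C ⊔ Z₂)))
    (h₆ : J₃₂₁ ≤ N ⊓ ((A ⊔ Z₃) ⊓ (B ⊔ Z₂) ⊓ (C ⊔ Z₁))) :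
    2 * (rk J₁₂₃ + rk J₁₃₂ + rk J₂₁₃ + rk J₂₃₁ + rk J₃₁₂ + rk J₃₂₁) + 6 * rk B + 6 * rk C +
        3 * rk (A ⊔ (B ⊔ C)) ≤
      3 * rk N + 3 * rk (shared (B ⊔ C) Z₁ Z₂ Z₃) +
        (rk ((A ⊔ Z₁) ⊓ (A ⊔ Z₂)) + rk ((A ⊔ Z₁) ⊓ (A ⊔ Z₃)) + rk ((A ⊔ Z₂) ⊓ (A ⊔ Z₃))) +
        2 * (rk ((B ⊔ Z₁) ⊓ (B ⊔ Z₂)) + rk ((B ⊔ Z₁) ⊓ (B ⊔ Z₃)) + rk ((B ⊔ Z₂) ⊓ (B ⊔ Z₃))) +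
        2 * (rk ((C ⊔ Z₁) ⊓ (C ⊔ Z₂)) + rk ((C ⊔ Z₁) ⊓ (C ⊔ Z₃)) +
          rk ((C ⊔ Z₂) ⊓ (C ⊔ Z₃))) := by
  -- With the user requesting `A` fixed, the other two users can request `B` and `C` in two ways.
  have key : ∀ {j k l : Submodule 𝕜 U} {J J' : Submodule 𝕜 U},
      J ≤ N ⊓ ((A ⊔ j) ⊓ (B ⊔ k) ⊓ (C ⊔ l)) → J' ≤ N ⊓ ((A ⊔ j) ⊓ (B ⊔ l) ⊓ (C ⊔ k)) →
      rk J + rk J' + rk B + rk C ≤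
        rk ((A ⊔ j) ⊓ N) + rk ((B ⊔ k) ⊓ (B ⊔ l)) + rk ((C ⊔ k) ⊓ (C ⊔ l)) := by
    intro j k l J J' hJ hJ'
    simp only [le_inf_iff] at hJ hJ'
    obtain ⟨a, ⟨b, c⟩, d⟩ := hJ
    obtain ⟨a', ⟨b', c'⟩, d'⟩ := hJ'
    exact rk_add_le_of_inf_le hBC (le_inf b a) (le_inf b' a') c d c' d'
  have k1 := key h₁ h₂
  have k2 := key h₃ h₄
  have k3 := key h₅ h₆
  have hS : A ⊔ (B ⊔ C) ≤ A ⊔ shared (B ⊔ C) Z₁ Z₂ Z₃ := sup_le_sup_left (le_shared _ _ _ _) _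
  -- Each `(A ⊔ Z j) ⊓ N` occurs in two of these three bounds, so the bounds from `key` are taken
  -- twice.
  have p1 := rk_inf_pair_le (Z₁ := Z₁) (Z₂ := Z₂) hN hS
  have p2 := rk_inf_pair_le (Z₁ := Z₁) (Z₂ := Z₃) hN hS
  have p3 := rk_inf_pair_le (Z₁ := Z₂) (Z₂ := Z₃) hN hS
  linarith

/-- The inequality for three documents of arbitrary dimensions that are fully used by caches
contained in their sum. `X j k l` is the broadcast if users `j`, `k`, `l` request the documents
`W 0`, `W 1`, `W 2`, respectively. -/
theorem rk_documents_le_of_full (W Z : Fin 3 → Submodule 𝕜 U)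
    (X : Fin 3 → Fin 3 → Fin 3 → Submodule 𝕜 U)
    (h01 : Disjoint (W 0) (W 1)) (h012 : Disjoint (W 0 ⊔ W 1) (W 2))
    (f0 : W 0 ≤ W 1 ⊔ W 2 ⊔ Z 0 ⊔ Z 1 ⊔ Z 2) (f1 : W 1 ≤ W 0 ⊔ W 2 ⊔ Z 0 ⊔ Z 1 ⊔ Z 2)
    (f2 : W 2 ≤ W 0 ⊔ W 1 ⊔ Z 0 ⊔ Z 1 ⊔ Z 2)
    (d0 : ∀ j k l, j ≠ k → j ≠ l → k ≠ l → W 0 ≤ Z j ⊔ X j k l)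
    (d1 : ∀ j k l, j ≠ k → j ≠ l → k ≠ l → W 1 ≤ Z k ⊔ X j k l)
    (d2 : ∀ j k l, j ≠ k → j ≠ l → k ≠ l → W 2 ≤ Z l ⊔ X j k l) :
    22 * (rk (W 0) + rk (W 1) + rk (W 2)) ≤
      5 * (rk (X 0 1 2) + rk (X 0 2 1) + rk (X 1 0 2) + rk (X 1 2 0) + rk (X 2 0 1) +
        rk (X 2 1 0)) + 12 * (rk (Z 0) + rk (Z 1) + rk (Z 2)) := by
  have h12 : Disjoint (W 1) (W 2) := h012.mono_left le_sup_right
  have h02 : Disjoint (W 0) (W 2) := h012.mono_left le_sup_left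
  set S := W 0 ⊔ W 1 ⊔ W 2 with hSdef
  have hS : rk S = rk (W 0) + rk (W 1) + rk (W 2) := by
    rw [hSdef, rk_sup_of_disjoint h012, rk_sup_of_disjoint h01]
  have hS0 : W 0 ⊔ (W 1 ⊔ W 2) = S := by rw [hSdef, sup_assoc]
  have hS1 : W 1 ⊔ (W 0 ⊔ W 2) = S := by rw [← hS0, sup_left_comm]
  have hS2 : W 2 ⊔ (W 0 ⊔ W 1) = S := by rw [hSdef, sup_comm]
  have up : ∀ {H V : Submodule 𝕜 U}, V ≤ H ⊔ Z 0 ⊔ Z 1 ⊔ Z 2 → V ⊔ H = S →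
      S ≤ H ⊔ Z 0 ⊔ Z 1 ⊔ Z 2 := by
    intro H V hV e
    rw [← e]
    exact sup_le hV (le_sup_left.trans (le_sup_left.trans le_sup_left))
  have s0 := rk_shared_le (Z 0) (Z 1) (Z 2) (up f0 hS0)
  have s1 := rk_shared_le (Z 0) (Z 1) (Z 2) (up f1 hS1)
  have s2 := rk_shared_le (Z 0) (Z 1) (Z 2) (up f2 hS2)
  set α := shared (W 1 ⊔ W 2) (Z 0) (Z 1) (Z 2) with hα
  set β := shared (W 0 ⊔ W 2) (Z 0) (Z 1) (Z 2) with hβ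
  set γ := shared (W 0 ⊔ W 1) (Z 0) (Z 1) (Z 2) with hγ
  have a1 : W 1 ⊔ W 2 ≤ α := le_shared _ _ _ _
  have a2 : W 0 ⊔ W 2 ≤ β := le_shared _ _ _ _
  have a3 : W 0 ⊔ W 1 ≤ γ := le_shared _ _ _ _
  have hn := rk_inf_three_le (S := S) (α := α) (β := β) (γ := γ)
    (by
      rw [← hS0]
      exact sup_le ((le_inf (le_sup_left.trans a2) (le_sup_left.trans a3)).trans le_sup_right)
        (a1.trans le_sup_left))
    (by
      rw [← hS1]
      exact sup_le ((le_sup_right.trans a3).trans le_sup_right) (a2.trans le_sup_left))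
  set N := α ⊓ (β ⊓ γ) with hN
  set J : Fin 3 → Fin 3 → Fin 3 → Submodule 𝕜 U :=
    fun j k l => (W 0 ⊔ Z j) ⊓ (W 1 ⊔ Z k) ⊓ (W 2 ⊔ Z l) with hJ
  have hJN : ∀ j k l, j ≠ k → j ≠ l → k ≠ l → J j k l ≤ N := by
    intro j k l hjk hjl hkl
    refine le_inf ?_ (le_inf ?_ ?_)
    · refine inf_three_le_shared (P := (W 1 ⊔ Z k) ⊓ (W 2 ⊔ Z l)) ?_
        (le_inf (inf_le_left.trans inf_le_right) inf_le_right)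
      fin_cases k <;> fin_cases l <;> simp at hkl ⊢
    · refine inf_three_le_shared (P := (W 0 ⊔ Z j) ⊓ (W 2 ⊔ Z l)) ?_
        (le_inf (inf_le_left.trans inf_le_left) inf_le_right)
      fin_cases j <;> fin_cases l <;> simp at hjl ⊢
    · refine inf_three_le_shared (P := (W 0 ⊔ Z j) ⊓ (W 1 ⊔ Z k)) ?_ inf_le_left
      fin_cases j <;> fin_cases k <;> simp at hjk ⊢
  have g0 : ∀ j k l, j ≠ k → j ≠ l → k ≠ l →
      J j k l ≤ N ⊓ ((W 0 ⊔ Z j) ⊓ (W 1 ⊔ Z k) ⊓ (W 2 ⊔ Z l)) :=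
    fun j k l a b c => le_inf (hJN j k l a b c) le_rfl
  have g1 : ∀ j k l, j ≠ k → j ≠ l → k ≠ l →
      J k j l ≤ N ⊓ ((W 1 ⊔ Z j) ⊓ (W 0 ⊔ Z k) ⊓ (W 2 ⊔ Z l)) :=
    fun j k l a b c => le_inf (hJN k j l a.symm c b) (le_of_eq (by rw [hJ, inf_comm (W 1 ⊔ Z j)]))
  have g2 : ∀ j k l, j ≠ k → j ≠ l → k ≠ l →
      J k l j ≤ N ⊓ ((W 2 ⊔ Z j) ⊓ (W 0 ⊔ Z k) ⊓ (W 1 ⊔ Z l)) :=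
    fun j k l a b c => le_inf (hJN k l j c a.symm b.symm)
      (le_of_eq (by rw [hJ, inf_assoc (W 2 ⊔ Z j), inf_comm (W 2 ⊔ Z j)]))
  have n01 : (0 : Fin 3) ≠ 1 := by decide
  have n02 : (0 : Fin 3) ≠ 2 := by decide
  have n12 : (1 : Fin 3) ≠ 2 := by decide
  have m0 := rk_meet_document_le h12 (inf_le_left : N ≤ α)
    (g0 0 1 2 n01 n02 n12) (g0 0 2 1 n02 n01 n12.symm) (g0 1 0 2 n01.symm n12 n02)
    (g0 1 2 0 n12 n01.symm n02.symm) (g0 2 0 1 n02.symm n12.symm n01)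
    (g0 2 1 0 n12.symm n02.symm n01.symm)
  have m1 := rk_meet_document_le h02 (inf_le_right.trans inf_le_left : N ≤ β)
    (g1 0 1 2 n01 n02 n12) (g1 0 2 1 n02 n01 n12.symm) (g1 1 0 2 n01.symm n12 n02)
    (g1 1 2 0 n12 n01.symm n02.symm) (g1 2 0 1 n02.symm n12.symm n01)
    (g1 2 1 0 n12.symm n02.symm n01.symm)
  have m2 := rk_meet_document_le h01 (inf_le_right.trans inf_le_right : N ≤ γ)
    (g2 0 1 2 n01 n02 n12) (g2 0 2 1 n02 n01 n12.symm) (g2 1 0 2 n01.symm n12 n02)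
    (g2 1 2 0 n12 n01.symm n02.symm) (g2 2 0 1 n02.symm n12.symm n01)
    (g2 2 1 0 n12.symm n02.symm n01.symm)
  rw [hS0, ← hα, ← hN] at m0
  rw [hS1, ← hβ, ← hN] at m1
  rw [hS2, ← hγ, ← hN] at m2
  have b : ∀ j k l, j ≠ k → j ≠ l → k ≠ l → _ := fun j k l p q r =>
    rk_broadcast_ge (d0 j k l p q r) (d1 j k l p q r) (d2 j k l p q r) (le_refl (J j k l))
  have b1 := b 0 1 2 n01 n02 n12
  have b2 := b 0 2 1 n02 n01 n12.symm
  have b3 := b 1 0 2 n01.symm n12 n02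
  have b4 := b 1 2 0 n12 n01.symm n02.symm
  have b5 := b 2 0 1 n02.symm n12.symm n01
  have b6 := b 2 1 0 n12.symm n02.symm n01.symm
  have c10 : ∀ i, (W i ⊔ Z 1) ⊓ (W i ⊔ Z 0) = (W i ⊔ Z 0) ⊓ (W i ⊔ Z 1) :=
    fun i => inf_comm _ _
  have c20 : ∀ i, (W i ⊔ Z 2) ⊓ (W i ⊔ Z 0) = (W i ⊔ Z 0) ⊓ (W i ⊔ Z 2) :=
    fun i => inf_comm _ _
  have c21 : ∀ i, (W i ⊔ Z 2) ⊓ (W i ⊔ Z 1) = (W i ⊔ Z 1) ⊓ (W i ⊔ Z 2) :=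
    fun i => inf_comm _ _
  simp only [c10, c20, c21, sup_comm (Z 1) (Z 0), sup_comm (Z 2) (Z 0), sup_comm (Z 2) (Z 1)]
    at b1 b2 b3 b4 b5 b6
  have t : ∀ i j k, rk (W i) ≤ rk ((W i ⊔ Z j) ⊓ (W i ⊔ Z k)) :=
    fun i j k => rk_mono (le_inf le_sup_left le_sup_left)
  -- Weights: 1 for each `b`, 1/3 for each `m`, 3 for `hn`, 4 for each `s`. The terms in `W i ⊓ Z
  -- j`, the spaces `J`, `N` and the two-user sums cancel. The pair meets remain with coefficient `4
  -- - 5/3 = 7/3`, and the bounds `t` turn them into `7 * rk S`; with `37 * rk S` from the rest this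
  -- makes `44 = 2 * 22`.
  linarith only [b1, b2, b3, b4, b5, b6, m0, m1, m2, s0, s1, s2, hn, hS, t 0 0 1, t 0 0 2, t 0 1 2,
    t 1 0 1, t 1 0 2, t 1 1 2, t 2 0 1, t 2 0 2, t 2 1 2]

end Submodule

/-! ### Splitting off the unused parts of the documents. -/

namespace Submodule

variable {𝕜 U : Type*} [Field 𝕜] [AddCommGroup U] [Module 𝕜 U]

/-- The part of a document `A` that is used by the caches, whose sum is `Z`, where `H` is the sum
of the other documents. -/
def used (A H Z : Submodule 𝕜 U) : Submodule 𝕜 U := A ⊓ (H ⊔ Z)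

theorem used_le (A H Z : Submodule 𝕜 U) : used A H Z ≤ A := inf_le_left

/-- The component of `y ∈ Y` in one document is `y` minus its components in the other two, hence
lies in the sum of these documents and `Z`. -/
theorem le_sup_used {A B C Z Y : Submodule 𝕜 U} (hY : Y ≤ A ⊔ B ⊔ C) (hYZ : Y ≤ Z) :
    Y ≤ used A (B ⊔ C) Z ⊔ used B (A ⊔ C) Z ⊔ used C (A ⊔ B) Z := by
  intro y hy
  obtain ⟨s, hs, c, hc, hsc⟩ := mem_sup.1 (hY hy)
  obtain ⟨a, ha, b, hb, rfl⟩ := mem_sup.1 hs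
  have key : ∀ {H : Submodule 𝕜 U} {u h : U}, u + h = y → h ∈ H → u ∈ H ⊔ Z := by
    intro H u h e hh
    rw [eq_sub_of_add_eq e]
    exact sub_mem (le_sup_right (a := H) (hYZ hy)) (le_sup_left (b := Z) hh)
  rw [← hsc]
  refine add_mem_sup (add_mem_sup ⟨ha, ?_⟩ ⟨hb, ?_⟩) ⟨hc, ?_⟩
  · exact key (h := b + c) (by rw [← hsc, add_assoc]) (add_mem_sup hb hc)
  · exact key (h := a + c) (by rw [← hsc]; abel) (add_mem_sup ha hc)
  · exact key (h := a + b) (by rw [← hsc]; abel) (add_mem_sup ha hb)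

/-- The used parts are fully used even when the other documents are cut down to their used parts:
for `a = h + z` and `z = a₁ + h₁`, the component of `a` along `H` vanishes, so `h = -h₁` lies in `B'
⊔ C'`. -/
theorem used_le_sup_used {A H A' B' C' Z : Submodule 𝕜 U} (hA : Disjoint A H)
    (hA' : A' ≤ A) (hB' : B' ≤ H) (hC' : C' ≤ H) (hZ : Z ≤ A' ⊔ (B' ⊔ C')) :
    used A H Z ≤ B' ⊔ C' ⊔ Z := by
  rintro a ⟨ha, hz⟩
  obtain ⟨h, hh, z, hzZ, rfl⟩ := mem_sup.1 hz
  obtain ⟨a₁, ha₁, h₁, hh₁, rfl⟩ := mem_sup.1 (hZ hzZ)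
  have h0 : h + h₁ = 0 := by
    refine disjoint_def.1 hA _ ?_ (add_mem hh (sup_le hB' hC' hh₁))
    have := sub_mem ha (hA' ha₁)
    rwa [show h + (a₁ + h₁) - a₁ = h + h₁ by abel] at this
  have h2 : h = -h₁ := eq_neg_of_add_eq_zero_left h0
  rw [h2]
  exact add_mem_sup (neg_mem hh₁) hzZ

theorem le_sup_inf_of_le_sup {A A' Z S X : Submodule 𝕜 U} (h : A ≤ Z ⊔ X) (hA : A' ≤ A)
    (hAS : A' ≤ S) (hZ : Z ≤ S) : A' ≤ Z ⊔ X ⊓ S := by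
  rw [← sup_inf_assoc_of_le X hZ]
  exact le_inf (hA.trans h) hAS

variable [FiniteDimensional 𝕜 U]

/-- The inequality for three documents of arbitrary dimensions. `X j k l` is the broadcast if
users `j`, `k`, `l` request the documents `W 0`, `W 1`, `W 2`, respectively. -/
theorem rk_documents_add_unused_le (W Z : Fin 3 → Submodule 𝕜 U)
    (X : Fin 3 → Fin 3 → Fin 3 → Submodule 𝕜 U) (hW : iSupIndep W)
    (hZ : ∀ j, Z j ≤ W 0 ⊔ W 1 ⊔ W 2)
    (d0 : ∀ j k l, j ≠ k → j ≠ l → k ≠ l → W 0 ≤ Z j ⊔ X j k l)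
    (d1 : ∀ j k l, j ≠ k → j ≠ l → k ≠ l → W 1 ≤ Z k ⊔ X j k l)
    (d2 : ∀ j k l, j ≠ k → j ≠ l → k ≠ l → W 2 ≤ Z l ⊔ X j k l) :
    30 * (rk (W 0) + rk (W 1) + rk (W 2)) ≤
      8 * (rk (used (W 0) (W 1 ⊔ W 2) (⨆ j, Z j)) + rk (used (W 1) (W 0 ⊔ W 2) (⨆ j, Z j)) +
        rk (used (W 2) (W 0 ⊔ W 1) (⨆ j, Z j))) +
      5 * (rk (X 0 1 2) + rk (X 0 2 1) + rk (X 1 0 2) + rk (X 1 2 0) + rk (X 2 0 1) +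
        rk (X 2 1 0)) + 12 * (rk (Z 0) + rk (Z 1) + rk (Z 2)) := by
  have i0 : Disjoint (W 0) (W 1 ⊔ W 2) :=
    (hW 0).mono_right (sup_le (le_iSup₂_of_le 1 (by decide) le_rfl)
      (le_iSup₂_of_le 2 (by decide) le_rfl))
  have i1 : Disjoint (W 1) (W 0 ⊔ W 2) :=
    (hW 1).mono_right (sup_le (le_iSup₂_of_le 0 (by decide) le_rfl)
      (le_iSup₂_of_le 2 (by decide) le_rfl))
  have i2 : Disjoint (W 2) (W 0 ⊔ W 1) :=
    (hW 2).mono_right (sup_le (le_iSup₂_of_le 0 (by decide) le_rfl)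
      (le_iSup₂_of_le 1 (by decide) le_rfl))
  set T := ⨆ j, Z j with hT
  set A := used (W 0) (W 1 ⊔ W 2) T with hA
  set B := used (W 1) (W 0 ⊔ W 2) T with hB
  set C := used (W 2) (W 0 ⊔ W 1) T with hC
  have lA : A ≤ W 0 := used_le _ _ _
  have lB : B ≤ W 1 := used_le _ _ _
  have lC : C ≤ W 2 := used_le _ _ _
  have hTS : T ≤ A ⊔ B ⊔ C := le_sup_used (iSup_le hZ) le_rfl
  have hZS : ∀ j, Z j ≤ A ⊔ B ⊔ C := fun j => (le_iSup Z j).trans hTS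
  have hT3 : T = Z 0 ⊔ Z 1 ⊔ Z 2 := by
    refine le_antisymm (iSup_le fun j => ?_)
      (sup_le (sup_le (le_iSup Z 0) (le_iSup Z 1)) (le_iSup Z 2))
    fin_cases j
    exacts [le_sup_left.trans le_sup_left, le_sup_right.trans le_sup_left, le_sup_right]
  have e3 : ∀ H : Submodule 𝕜 U, H ⊔ Z 0 ⊔ Z 1 ⊔ Z 2 = H ⊔ T := by
    intro H
    rw [hT3, sup_assoc, sup_assoc, sup_assoc]
  have fA : A ≤ B ⊔ C ⊔ T := used_le_sup_used i0 lA
    (lB.trans le_sup_left) (lC.trans le_sup_right) (hTS.trans (sup_assoc _ _ _).le)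
  have fB : B ≤ A ⊔ C ⊔ T := used_le_sup_used i1 lB
    (lA.trans le_sup_left) (lC.trans le_sup_right)
    (hTS.trans (by rw [sup_left_comm, sup_assoc]))
  have fC : C ≤ A ⊔ B ⊔ T := used_le_sup_used i2 lC
    (lA.trans le_sup_left) (lB.trans le_sup_right) (hTS.trans (sup_comm _ _).le)
  have main := rk_documents_le_of_full ![A, B, C] Z (fun j k l => X j k l ⊓ (A ⊔ B ⊔ C))
    (i0.mono lA (lB.trans le_sup_left)) (i2.symm.mono (sup_le_sup lA lB) lC)
    (by rw [e3]; exact fA) (by rw [e3]; exact fB) (by rw [e3]; exact fC)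
    (fun j k l p q r => le_sup_inf_of_le_sup (d0 j k l p q r) lA
      (le_sup_left.trans le_sup_left) (hZS j))
    (fun j k l p q r => le_sup_inf_of_le_sup (d1 j k l p q r) lB
      (le_sup_right.trans le_sup_left) (hZS k))
    (fun j k l p q r => le_sup_inf_of_le_sup (d2 j k l p q r) lC le_sup_right (hZS l))
  -- The caches lie in the sum of the used parts, so `X` and the used parts together span all
  -- documents. Restricting `X` to the used parts therefore costs at least the unused dimensions.
  -- Over six broadcasts with weight 5 these count 30 times, and `8 = 30 - 22`.
  have hX : ∀ j k l, j ≠ k → j ≠ l → k ≠ l →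
      rk (X j k l ⊓ (A ⊔ B ⊔ C)) + (rk (W 0) + rk (W 1) + rk (W 2)) ≤
        rk (X j k l) + (rk A + rk B + rk C) := by
    intro j k l p q r
    have h1 := rk_sup_add_rk_inf (X j k l) (A ⊔ B ⊔ C)
    have h2 : rk (W 0 ⊔ W 1 ⊔ W 2) ≤ rk (X j k l ⊔ (A ⊔ B ⊔ C)) := by
      refine rk_mono (sup_le (sup_le ((d0 j k l p q r).trans ?_) ((d1 j k l p q r).trans ?_))
        ((d2 j k l p q r).trans ?_)) <;>
      exact sup_le ((hZS _).trans le_sup_right) le_sup_left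
    rw [rk_sup_of_disjoint i2.symm, rk_sup_of_disjoint (i0.mono_right le_sup_left)] at h2
    rw [rk_sup_of_disjoint (i2.symm.mono (sup_le_sup lA lB) lC),
      rk_sup_of_disjoint (i0.mono lA (lB.trans le_sup_left))] at h1
    linarith
  have x1 := hX 0 1 2 (by decide) (by decide) (by decide)
  have x2 := hX 0 2 1 (by decide) (by decide) (by decide)
  have x3 := hX 1 0 2 (by decide) (by decide) (by decide)
  have x4 := hX 1 2 0 (by decide) (by decide) (by decide)
  have x5 := hX 2 0 1 (by decide) (by decide) (by decide)
  have x6 := hX 2 1 0 (by decide) (by decide) (by decide)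
  change 22 * (rk A + rk B + rk C) ≤ _ at main
  linarith

end Submodule

/-! ### The inequality for arbitrary schemes. -/

namespace LinearCachingScheme

open Submodule

variable {𝕜 U : Type*} [Field 𝕜] [AddCommGroup U] [Module 𝕜 U] [FiniteDimensional 𝕜 U] {F : ℕ}

/-- The demand in which users `j`, `k`, `l` request the documents `0`, `1`, `2`. -/
def demand (j k _l : Fin 3) : Fin 3 → Fin 3 := fun u => if u = j then 0 else if u = k then 1 else 2

/-- The inequality for a scheme with caches in the sum of the documents, with a term for the parts
of the documents that are not used by the caches. -/
theorem le_of_caches_le (S : LinearCachingScheme 𝕜 U 3 3 F) {M R : ℝ} (hMR : S.Achieves M R)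
    (hZ : ∀ j, S.Z j ≤ S.W 0 ⊔ S.W 1 ⊔ S.W 2) :
    90 * (F : ℝ) ≤ 8 * (rk (used (S.W 0) (S.W 1 ⊔ S.W 2) (⨆ j, S.Z j)) +
        rk (used (S.W 1) (S.W 0 ⊔ S.W 2) (⨆ j, S.Z j)) +
        rk (used (S.W 2) (S.W 0 ⊔ S.W 1) (⨆ j, S.Z j))) + (30 * R + 36 * M) * F := by
  have h := rk_documents_add_unused_le S.W S.Z (fun j k l => S.X (demand j k l)) S.indep hZ
    (fun j k l _ _ _ => by simpa [demand] using S.decode j (demand j k l))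
    (fun j k l p _ _ => by simpa [demand, p.symm] using S.decode k (demand j k l))
    (fun j k l _ q r => by simpa [demand, q.symm, r.symm] using S.decode l (demand j k l))
  have hF : ∀ i, rk (S.W i) = F := fun i => by rw [rk, S.finrank_W]
  obtain ⟨hM, hR⟩ := hMR
  change ∀ j, rk (S.Z j) ≤ _ at hM
  change ∀ d, rk (S.X d) ≤ _ at hR
  have hM0 := hM 0
  have hM1 := hM 1
  have hM2 := hM 2
  have r1 := hR (demand 0 1 2)
  have r2 := hR (demand 0 2 1)
  have r3 := hR (demand 1 0 2)
  have r4 := hR (demand 1 2 0)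
  have r5 := hR (demand 2 0 1)
  have r6 := hR (demand 2 1 0)
  rw [hF, hF, hF] at h
  linarith

/-- The image of a scheme under a linear map that fixes the documents. -/
def mapOfFixes (S : LinearCachingScheme 𝕜 U 3 3 F) (p : U →ₗ[𝕜] U)
    (hp : ∀ i, ∀ w ∈ S.W i, p w = w) : LinearCachingScheme 𝕜 U 3 3 F where
  W := S.W
  Z j := (S.Z j).map p
  X d := (S.X d).map p
  indep := S.indep
  finrank_W := S.finrank_W
  decode j d := by
    rw [← Submodule.map_sup]
    exact fun w hw => ⟨w, S.decode j d hw, hp _ w hw⟩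

theorem Achieves.mapOfFixes {S : LinearCachingScheme 𝕜 U 3 3 F} {M R : ℝ} (h : S.Achieves M R)
    (p : U →ₗ[𝕜] U) (hp : ∀ i, ∀ w ∈ S.W i, p w = w) : (S.mapOfFixes p hp).Achieves M R :=
  ⟨fun j => (Nat.cast_le.2 (Submodule.finrank_map_le p (S.Z j))).trans (h.1 j),
    fun d => (Nat.cast_le.2 (Submodule.finrank_map_le p (S.X d))).trans (h.2 d)⟩

/-- A projection onto the sum of the documents preserves decoding and does not increase dimensions,
so `le_of_caches_le` applies to the image. -/
theorem eleven_le (hF : 0 < F) (S : LinearCachingScheme 𝕜 U 3 3 F) {M R : ℝ}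
    (hMR : S.Achieves M R) : 11 ≤ 6 * M + 5 * R := by
  obtain ⟨q, hq⟩ := Submodule.exists_isCompl (S.W 0 ⊔ S.W 1 ⊔ S.W 2)
  set V := S.W 0 ⊔ S.W 1 ⊔ S.W 2 with hV
  have hWV : ∀ i, S.W i ≤ V := by
    intro i
    fin_cases i
    exacts [le_sup_left.trans le_sup_left, le_sup_right.trans le_sup_left, le_sup_right]
  obtain ⟨f, hf⟩ := LinearMap.exists_leftInverse_of_injective V.subtype (by simp)
  have hp : ∀ i, ∀ w ∈ S.W i, (V.subtype ∘ₗ f) w = w := fun i w hw =>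
    congrArg Subtype.val (LinearMap.congr_fun hf ⟨w, hWV i hw⟩)
  have h := le_of_caches_le _ (hMR.mapOfFixes _ hp) (by
    rintro j _ ⟨z, -, rfl⟩
    exact (f z).2)
  -- Bounding each used part by the whole document leaves `90 - 8 * 3 = 66 = 6 * 11`.
  have hu : ∀ i H T, rk (used (S.W i) H T) ≤ F := by
    intro i H T
    have := rk_mono (used_le (S.W i) H T)
    rwa [rk, rk, S.finrank_W] at this
  have h0 := hu 0 (S.W 1 ⊔ S.W 2) (⨆ j, (S.mapOfFixes _ hp).Z j)
  have h1 := hu 1 (S.W 0 ⊔ S.W 2) (⨆ j, (S.mapOfFixes _ hp).Z j)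
  have h2 := hu 2 (S.W 0 ⊔ S.W 1) (⨆ j, (S.mapOfFixes _ hp).Z j)
  change 90 * (F : ℝ) ≤ 8 * (rk (used (S.W 0) (S.W 1 ⊔ S.W 2) _) +
    rk (used (S.W 1) (S.W 0 ⊔ S.W 2) _) + rk (used (S.W 2) (S.W 0 ⊔ S.W 1) _)) + _ at h
  have hF' : (0 : ℝ) < F := Nat.cast_pos.2 hF
  refine le_of_mul_le_mul_right ?_ hF'
  linarith

end LinearCachingScheme

/-! ### The improved bound for symmetric schemes with ratios. -/

namespace LinearCachingScheme

open Submodule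

variable {𝕜 U : Type*} [Field 𝕜] [AddCommGroup U] [Module 𝕜 U] {F : ℕ}

theorem rk_map_equiv (e : U ≃ₗ[𝕜] U) (p : Submodule 𝕜 U) : rk (p.map e.toLinearMap) = rk p := by
  unfold rk
  exact_mod_cast LinearEquiv.finrank_map_eq e p

theorem map_used (e : U ≃ₗ[𝕜] U) (A H Z : Submodule 𝕜 U) :
    (used A H Z).map e.toLinearMap =
      used (A.map e.toLinearMap) (H.map e.toLinearMap) (Z.map e.toLinearMap) := by
  unfold used
  rw [Submodule.map_inf _ e.injective, Submodule.map_sup]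

/-- An automorphism that swaps two documents and preserves every cache carries one used part to the
other. -/
theorem IsSymmetric.rk_used_eq {S : LinearCachingScheme 𝕜 U 3 3 F} (h : S.IsSymmetric) :
    rk (used (S.W 1) (S.W 0 ⊔ S.W 2) (⨆ j, S.Z j)) =
      rk (used (S.W 0) (S.W 1 ⊔ S.W 2) (⨆ j, S.Z j)) ∧
    rk (used (S.W 2) (S.W 0 ⊔ S.W 1) (⨆ j, S.Z j)) =
      rk (used (S.W 0) (S.W 1 ⊔ S.W 2) (⨆ j, S.Z j)) := by
  constructor
  · obtain ⟨e, hW, hZ, -⟩ := h 1 (Equiv.swap 0 1)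
    rw [← rk_map_equiv e (used (S.W 0) _ _), map_used, Submodule.map_sup, Submodule.map_iSup,
      hW, hW, hW]
    simp only [hZ]
    rfl
  · obtain ⟨e, hW, hZ, -⟩ := h 1 (Equiv.swap 0 2)
    rw [← rk_map_equiv e (used (S.W 0) _ _), map_used, Submodule.map_sup, Submodule.map_iSup,
      hW, hW, hW, sup_comm (S.W 0)]
    simp only [hZ]
    rfl

theorem twoWaySum_le {A B : Submodule 𝕜 U} (e : A ≃ₗ[𝕜] B) : twoWaySum e ≤ A ⊔ B := by
  rintro _ ⟨a, rfl⟩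
  exact add_mem_sup a.2 (e a).2

theorem threeWaySum_le {A B C : Submodule 𝕜 U} (e : A ≃ₗ[𝕜] B) (f : A ≃ₗ[𝕜] C) :
    threeWaySum e f ≤ A ⊔ B ⊔ C := by
  rintro _ ⟨a, rfl⟩
  exact add_mem_sup (add_mem_sup a.2 (e a).2) (f a).2

theorem le_of_decomposition {W : Fin 3 → Submodule 𝕜 U} {Z : Submodule 𝕜 U}
    (D : CacheDecomposition W Z) : Z ≤ (⨆ k, D.P 0 k) ⊔ (W 1 ⊔ W 2) := by
  have h0 : ∀ k, D.P 0 k ≤ (⨆ k, D.P 0 k) ⊔ (W 1 ⊔ W 2) :=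
    fun k => (le_iSup (D.P 0) k).trans le_sup_left
  have h1 : ∀ k, D.P 1 k ≤ (⨆ k, D.P 0 k) ⊔ (W 1 ⊔ W 2) :=
    fun k => (D.le_W 1 k).trans (le_sup_left.trans le_sup_right)
  have h2 : ∀ k, D.P 2 k ≤ (⨆ k, D.P 0 k) ⊔ (W 1 ⊔ W 2) :=
    fun k => (D.le_W 2 k).trans (le_sup_right.trans le_sup_right)
  refine D.eq_sup.le.trans (sup_le (sup_le (sup_le (sup_le (sup_le (h0 _) (h1 _)) (h2 _))
    (sup_le ((twoWaySum_le _).trans (sup_le (h0 _) (h1 _)))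
      ((twoWaySum_le _).trans (sup_le (h1 _) (h2 _)))))
    (sup_le (sup_le ((twoWaySum_le _).trans (sup_le (h0 _) (h1 _)))
      ((twoWaySum_le _).trans (sup_le (h0 _) (h2 _))))
      ((twoWaySum_le _).trans (sup_le (h1 _) (h2 _)))))
    ((threeWaySum_le _ _).trans (sup_le (sup_le (h0 _) (h1 _)) (h2 _))))

theorem caches_le_of_decomposition {S : LinearCachingScheme 𝕜 U 3 3 F}
    (D : ∀ j, CacheDecomposition S.W (S.Z j)) (j : Fin 3) :
    S.Z j ≤ S.W 0 ⊔ S.W 1 ⊔ S.W 2 := by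
  refine (le_of_decomposition (D j)).trans ?_
  rw [sup_assoc]
  exact sup_le_sup_right (iSup_le ((D j).le_W 0)) _

/-- Modulo `W 1 ⊔ W 2`, each cache is contained in its own parts in `W 0`; the modular law and
independence of the documents do the rest. -/
theorem used_le_of_decomposition {S : LinearCachingScheme 𝕜 U 3 3 F}
    (D : ∀ j, CacheDecomposition S.W (S.Z j)) :
    used (S.W 0) (S.W 1 ⊔ S.W 2) (⨆ j, S.Z j) ≤ ⨆ j, ⨆ k, (D j).P 0 k := by
  have hQ : (⨆ j, ⨆ k, (D j).P 0 k) ≤ S.W 0 := iSup_le fun j => iSup_le fun k => (D j).le_W 0 k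
  have i0 : Disjoint (S.W 0) (S.W 1 ⊔ S.W 2) :=
    (S.indep 0).mono_right (sup_le (le_iSup₂_of_le 1 (by decide) le_rfl)
      (le_iSup₂_of_le 2 (by decide) le_rfl))
  have h : (S.W 1 ⊔ S.W 2) ⊔ (⨆ j, S.Z j) ≤ (⨆ j, ⨆ k, (D j).P 0 k) ⊔ (S.W 1 ⊔ S.W 2) :=
    sup_le le_sup_right (iSup_le fun j => (le_of_decomposition (D j)).trans
      (sup_le_sup_right (le_iSup (fun j => ⨆ k, (D j).P 0 k) j) _))
  unfold used
  refine (inf_le_inf_left _ h).trans ?_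
  rw [inf_comm, sup_inf_assoc_of_le _ hQ, inf_comm (S.W 1 ⊔ S.W 2), i0.eq_bot, sup_bot_eq]

theorem le_of_hasRatios [FiniteDimensional 𝕜 U] (hF : 0 < F)
    {S : LinearCachingScheme 𝕜 U 3 3 F} (hS : S.IsSymmetric)
    {M R r₁ r₂ r₃ r₄ r₅ : ℝ} (hMR : S.Achieves M R) (hr : S.HasRatios r₁ r₂ r₃ r₄ r₅) :
    11 + 15 / 2 * r₅ ≤ 6 * M + 5 * R := by
  obtain ⟨D, -, -, -, -, -, hr⟩ := hr
  have h := le_of_caches_le S hMR (caches_le_of_decomposition D)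
  rw [hS.rk_used_eq.1, hS.rk_used_eq.2] at h
  have h1 := rk_mono (used_le_of_decomposition D)
  -- This is `0 ≤ r₅`. It is needed because the other bounds give `11 + 12 * r₅`, which is then
  -- weakened to the coefficient `15 / 2`.
  have h2 : rk (⨆ j, ⨆ k, (D j).P 0 k) ≤ rk (S.W 0) :=
    rk_mono (iSup_le fun j => iSup_le fun k => (D j).le_W 0 k)
  have hW : rk (S.W 0) = F := by rw [rk, S.finrank_W]
  change 3 * (F : ℝ) * r₅ = F - rk (⨆ j, ⨆ k, (D j).P 0 k) at hr
  have hF' : (0 : ℝ) < F := Nat.cast_pos.2 hF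
  refine le_of_mul_le_mul_right ?_ hF'
  linarith

end LinearCachingScheme

/-! ### Linear algebra for decomposing a cache. -/

namespace Submodule

variable {𝕜 U : Type*} [Field 𝕜] [AddCommGroup U] [Module 𝕜 U]

theorem exists_projection {A H : Submodule 𝕜 U} (h : Disjoint A H) :
    ∃ p : U →ₗ[𝕜] U, (∀ x, p x ∈ A) ∧ (∀ x ∈ A, p x = x) ∧ ∀ x ∈ H, p x = 0 := by
  obtain ⟨q, hq, hc⟩ := h.symm.exists_isCompl
  exact ⟨A.projection q hc.symm, projection_apply_mem _,
    fun x hx => projection_apply_of_mem_left _ hx,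
    fun x hx => (projection_apply_eq_zero_iff _).2 (hq hx)⟩

/-- A linear choice of the second summand in a sum of two subspaces. -/
theorem exists_linear_summand {E K K' : Submodule 𝕜 U} (h : E ≤ K ⊔ K') :
    ∃ g : E →ₗ[𝕜] U, ∀ e : E, g e ∈ K' ∧ (e : U) - g e ∈ K := by
  have hr : LinearMap.range (K.subtype.coprod K'.subtype) = K ⊔ K' := by
    rw [LinearMap.range_coprod, range_subtype, range_subtype]
  obtain ⟨s, hs⟩ := LinearMap.exists_rightInverse_of_surjective
    (K.subtype.coprod K'.subtype).rangeRestrict (LinearMap.range_rangeRestrict _)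
  refine ⟨K'.subtype ∘ₗ LinearMap.snd 𝕜 K K' ∘ₗ s ∘ₗ inclusion (h.trans hr.ge),
    fun e => ⟨(Subtype.property _ : _), ?_⟩⟩
  have h1 := congrArg Subtype.val (LinearMap.congr_fun hs (inclusion (h.trans hr.ge) e))
  have h2 : (e : U) = ((s (inclusion (h.trans hr.ge) e)).1 : U) +
      ((s (inclusion (h.trans hr.ge) e)).2 : U) := h1.symm
  change (e : U) - ((s (inclusion (h.trans hr.ge) e)).2 : U) ∈ K
  rw [sub_eq_of_eq_add h2]
  exact (s (inclusion (h.trans hr.ge) e)).1.2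

theorem iSupIndep_fin_five {Q : Fin 5 → Submodule 𝕜 U}
    (h : ∀ a ∈ Q 0, ∀ b ∈ Q 1, ∀ c ∈ Q 2, ∀ d ∈ Q 3, ∀ e ∈ Q 4, a + b + c + d + e = 0 →
      a = 0 ∧ b = 0 ∧ c = 0 ∧ d = 0 ∧ e = 0) : iSupIndep Q := by
  rw [iSupIndep_iff_finsetSum_eq_zero_imp_eq_zero]
  intro s v hv hsum i hi
  have hu : ∀ i, (if i ∈ s then v i else 0) ∈ Q i := by
    intro i
    split_ifs with hi
    exacts [hv i hi, zero_mem _]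
  have hs : ∑ i, (if i ∈ s then v i else 0) = 0 := by simpa using hsum
  rw [Fin.sum_univ_five] at hs
  obtain ⟨h0, h1, h2, h3, h4⟩ := h _ (hu 0) _ (hu 1) _ (hu 2) _ (hu 3) _ (hu 4) hs
  have : (if i ∈ s then v i else 0) = 0 := by
    fin_cases i
    exacts [h0, h1, h2, h3, h4]
  rwa [if_pos hi] at this

/-- Complements vanish one after another: `l` lies in `Ka ⊔ Kb ⊔ Kc`, then `a` in `Ka ⊓ (Kb ⊔ Kc)`,
then `b` in `Kb ⊓ (Ka ⊔ Kc)`. The element `s` is harmless because it lies in both `Kb ⊔ Kc` and `Ka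
⊔ Kc`. -/
theorem eq_zero_of_add_mem {Ka Kb Kc La Lb L : Submodule 𝕜 U}
    (ha : Disjoint (Ka ⊓ (Kb ⊔ Kc)) La) (hb : Disjoint (Kb ⊓ (Ka ⊔ Kc)) Lb)
    (hL : Disjoint (Ka ⊔ Kb ⊔ Kc) L) (hLa : La ≤ Ka) (hLb : Lb ≤ Kb) {s a b l : U}
    (hs : s ∈ Kb ⊔ Kc) (hs' : s ∈ Ka ⊔ Kc) (haL : a ∈ La) (hbL : b ∈ Lb) (hlL : l ∈ L)
    (h : s + a + b + l ∈ Kc) : a = 0 ∧ b = 0 ∧ l = 0 := by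
  have hl : l = 0 := by
    refine disjoint_def.1 hL _ ?_ hlL
    rw [show l = (s + a + b + l) - s - a - b by abel]
    refine sub_mem (sub_mem (sub_mem (le_sup_right (a := Ka ⊔ Kb) h) ?_) ?_) ?_
    · exact (sup_le_sup_right le_sup_left _ : Ka ⊔ Kc ≤ Ka ⊔ Kb ⊔ Kc) hs'
    · exact (hLa.trans (le_sup_left.trans le_sup_left)) haL
    · exact (hLb.trans (le_sup_right.trans le_sup_left)) hbL
  subst hl
  rw [add_zero] at h
  have ha0 : a = 0 := by
    refine disjoint_def.1 ha _ ⟨hLa haL, ?_⟩ haL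
    rw [show a = (s + a + b) - s - b by abel]
    exact sub_mem (sub_mem (le_sup_right (a := Kb) h) hs) ((hLb.trans le_sup_left) hbL)
  subst ha0
  rw [add_zero] at h
  refine ⟨rfl, disjoint_def.1 hb _ ⟨hLb hbL, ?_⟩ hbL, rfl⟩
  rw [show b = (s + b) - s by abel]
  exact sub_mem (le_sup_right (a := Ka) h) hs'

section RangeEquiv

variable {E : Type*} [AddCommGroup E] [Module 𝕜 E]

/-- The isomorphism of the ranges of two injective linear maps. -/
noncomputable def rangeEquiv (f g : E →ₗ[𝕜] U) (hf : Function.Injective f)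
    (hg : Function.Injective g) : LinearMap.range f ≃ₗ[𝕜] LinearMap.range g :=
  (LinearEquiv.ofInjective f hf).symm.trans (LinearEquiv.ofInjective g hg)

theorem rangeEquiv_apply (f g : E →ₗ[𝕜] U) (hf : Function.Injective f)
    (hg : Function.Injective g) (x : E) :
    ((rangeEquiv f g hf hg (LinearEquiv.ofInjective f hf x) : LinearMap.range g) : U) = g x := by
  simp [rangeEquiv]

theorem twoWaySum_rangeEquiv (f g : E →ₗ[𝕜] U) (hf : Function.Injective f)
    (hg : Function.Injective g) :
    twoWaySum (rangeEquiv f g hf hg) = LinearMap.range (f + g) := by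
  unfold twoWaySum
  rw [← LinearEquiv.range_comp (LinearEquiv.ofInjective f hf)]
  congr 1
  ext x
  simp [rangeEquiv_apply]

theorem threeWaySum_rangeEquiv (f g h : E →ₗ[𝕜] U) (hf : Function.Injective f)
    (hg : Function.Injective g) (hh : Function.Injective h) :
    threeWaySum (rangeEquiv f g hf hg) (rangeEquiv f h hf hh) = LinearMap.range (f + g + h) := by
  unfold threeWaySum
  rw [← LinearEquiv.range_comp (LinearEquiv.ofInjective f hf)]
  congr 1
  ext x
  simp [rangeEquiv_apply]

end RangeEquiv

end Submodule

/-! ### Existence of a cache decomposition. -/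

section

open Submodule

variable {𝕜 U : Type*} [Field 𝕜] [AddCommGroup U] [Module 𝕜 U]

theorem exists_projections {W : Fin 3 → Submodule 𝕜 U} (hW : iSupIndep W) :
    ∃ p : Fin 3 → U →ₗ[𝕜] U, (∀ i x, p i x ∈ W i) ∧ (∀ i, ∀ x ∈ W i, p i x = x) ∧
      (∀ i j, j ≠ i → ∀ x ∈ W j, p i x = 0) ∧
      ∀ x ∈ W 0 ⊔ W 1 ⊔ W 2, p 0 x + p 1 x + p 2 x = x := by
  choose p h1 h2 h3 using fun i => exists_projection (hW i)
  have h4 : ∀ i j, j ≠ i → ∀ x ∈ W j, p i x = 0 := fun i j hji x hx =>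
    h3 i x ((le_iSup₂ (f := fun j (_ : j ≠ i) => W j) j hji) hx)
  refine ⟨p, h1, h2, h4, fun x hx => ?_⟩
  obtain ⟨s, hs, c, hc, rfl⟩ := mem_sup.1 hx
  obtain ⟨a, ha, b, hb, rfl⟩ := mem_sup.1 hs
  simp only [map_add, h2 0 a ha, h2 1 b hb, h2 2 c hc, h4 0 1 (by decide) b hb,
    h4 0 2 (by decide) c hc, h4 1 0 (by decide) a ha, h4 1 2 (by decide) c hc,
    h4 2 0 (by decide) a ha, h4 2 1 (by decide) b hb]
  abel

theorem injective_of_forall_eq_zero {L : Submodule 𝕜 U} {f : L →ₗ[𝕜] U}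
    (h : ∀ x : L, f x = 0 → (x : U) = 0) : Function.Injective f :=
  (injective_iff_map_eq_zero f).2 fun x hx => Subtype.ext (h x hx)

/-- Every cache in the sum of three independent documents has a decomposition, and the dimensions
of its parts are given by dimensions of intersections with sums of documents. -/
theorem exists_cacheDecomposition [FiniteDimensional 𝕜 U] {W : Fin 3 → Submodule 𝕜 U}
    (hW : iSupIndep W) {Z K₀₁ K₀₂ K₁₂ : Submodule 𝕜 U} (hZ : Z ≤ W 0 ⊔ W 1 ⊔ W 2)
    (h₀₁ : K₀₁ = Z ⊓ (W 0 ⊔ W 1)) (h₀₂ : K₀₂ = Z ⊓ (W 0 ⊔ W 2)) (h₁₂ : K₁₂ = Z ⊓ (W 1 ⊔ W 2)) :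
    ∃ D : CacheDecomposition W Z,
      (∀ i, rk (D.P i 0) = rk (Z ⊓ W i)) ∧
      rk (D.P 0 1) + rk (Z ⊓ W 0) + rk (Z ⊓ W 1) = rk (K₀₁ ⊓ (K₀₂ ⊔ K₁₂)) ∧
      rk (D.P 0 2) + rk (K₀₁ ⊓ (K₀₂ ⊔ K₁₂)) = rk K₀₁ ∧
      rk (D.P 0 3) + rk (K₀₂ ⊓ (K₀₁ ⊔ K₁₂)) = rk K₀₂ ∧
      rk (D.P 1 3) + rk (K₁₂ ⊓ (K₀₁ ⊔ K₀₂)) = rk K₁₂ ∧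
      rk (D.P 0 4) + rk (K₀₁ ⊔ K₀₂ ⊔ K₁₂) = rk Z := by
  obtain ⟨p, pW, pid, pz, psum⟩ := exists_projections hW
  have sum' : ∀ z ∈ Z, p 0 z + p 1 z + p 2 z = z := fun z hz => psum z (hZ hz)
  have m01 : ∀ z, z ∈ K₀₁ ↔ z ∈ Z ∧ p 2 z = 0 := by
    intro z
    rw [h₀₁]
    refine ⟨fun ⟨h1, h2⟩ => ⟨h1, ?_⟩, fun ⟨h1, h2⟩ => ⟨h1, ?_⟩⟩
    · obtain ⟨a, ha, b, hb, rfl⟩ := mem_sup.1 h2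
      rw [map_add, pz 2 0 (by decide) a ha, pz 2 1 (by decide) b hb, add_zero]
    · rw [← sum' z h1, h2, add_zero]
      exact add_mem_sup (pW _ _) (pW _ _)
  have m02 : ∀ z, z ∈ K₀₂ ↔ z ∈ Z ∧ p 1 z = 0 := by
    intro z
    rw [h₀₂]
    refine ⟨fun ⟨h1, h2⟩ => ⟨h1, ?_⟩, fun ⟨h1, h2⟩ => ⟨h1, ?_⟩⟩
    · obtain ⟨a, ha, b, hb, rfl⟩ := mem_sup.1 h2
      rw [map_add, pz 1 0 (by decide) a ha, pz 1 2 (by decide) b hb, add_zero]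
    · rw [← sum' z h1, h2, add_zero]
      exact add_mem_sup (pW _ _) (pW _ _)
  have m12 : ∀ z, z ∈ K₁₂ ↔ z ∈ Z ∧ p 0 z = 0 := by
    intro z
    rw [h₁₂]
    refine ⟨fun ⟨h1, h2⟩ => ⟨h1, ?_⟩, fun ⟨h1, h2⟩ => ⟨h1, ?_⟩⟩
    · obtain ⟨a, ha, b, hb, rfl⟩ := mem_sup.1 h2
      rw [map_add, pz 0 1 (by decide) a ha, pz 0 2 (by decide) b hb, add_zero]
    · rw [← sum' z h1, h2, zero_add]
      exact add_mem_sup (pW _ _) (pW _ _)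
  set D₀ := Z ⊓ W 0 with hD₀
  set D₁ := Z ⊓ W 1 with hD₁
  set D₂ := Z ⊓ W 2 with hD₂
  have m0 : ∀ z, z ∈ D₀ ↔ z ∈ Z ∧ p 1 z = 0 ∧ p 2 z = 0 := by
    refine fun z => ⟨fun ⟨h1, h2⟩ => ⟨h1, pz 1 0 (by decide) z h2, pz 2 0 (by decide) z h2⟩,
      fun ⟨h1, h2, h3⟩ => ⟨h1, ?_⟩⟩
    have := sum' z h1
    rw [h2, h3, add_zero, add_zero] at this
    exact this ▸ pW 0 z
  have m1 : ∀ z, z ∈ D₁ ↔ z ∈ Z ∧ p 0 z = 0 ∧ p 2 z = 0 := by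
    refine fun z => ⟨fun ⟨h1, h2⟩ => ⟨h1, pz 0 1 (by decide) z h2, pz 2 1 (by decide) z h2⟩,
      fun ⟨h1, h2, h3⟩ => ⟨h1, ?_⟩⟩
    have := sum' z h1
    rw [h2, h3, add_zero, zero_add] at this
    exact this ▸ pW 1 z
  have m2 : ∀ z, z ∈ D₂ ↔ z ∈ Z ∧ p 0 z = 0 ∧ p 1 z = 0 := by
    refine fun z => ⟨fun ⟨h1, h2⟩ => ⟨h1, pz 0 2 (by decide) z h2, pz 1 2 (by decide) z h2⟩,
      fun ⟨h1, h2, h3⟩ => ⟨h1, ?_⟩⟩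
    have := sum' z h1
    rw [h2, h3, zero_add, zero_add] at this
    exact this ▸ pW 2 z
  have k01 : K₀₁ ≤ Z := fun z hz => ((m01 z).1 hz).1
  have k02 : K₀₂ ≤ Z := fun z hz => ((m02 z).1 hz).1
  have k12 : K₁₂ ≤ Z := fun z hz => ((m12 z).1 hz).1
  have d001 : D₀ ≤ K₀₁ := fun z hz => (m01 z).2 ⟨hz.1, ((m0 z).1 hz).2.2⟩
  have d002 : D₀ ≤ K₀₂ := fun z hz => (m02 z).2 ⟨hz.1, ((m0 z).1 hz).2.1⟩
  have d101 : D₁ ≤ K₀₁ := fun z hz => (m01 z).2 ⟨hz.1, ((m1 z).1 hz).2.2⟩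
  have d112 : D₁ ≤ K₁₂ := fun z hz => (m12 z).2 ⟨hz.1, ((m1 z).1 hz).2.1⟩
  have d202 : D₂ ≤ K₀₂ := fun z hz => (m02 z).2 ⟨hz.1, ((m2 z).1 hz).2.2⟩
  have d212 : D₂ ≤ K₁₂ := fun z hz => (m12 z).2 ⟨hz.1, ((m2 z).1 hz).2.1⟩
  have hDQ : D₀ ⊔ D₁ ≤ K₀₁ ⊓ (K₀₂ ⊔ K₁₂) :=
    sup_le (le_inf d001 (d002.trans le_sup_left)) (le_inf d101 (d112.trans le_sup_right))
  -- `L` will be the triple part, `L₀₁`, `L₀₂`, `L₁₂` the two-way parts, and `E` the `A`-`B` half of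
  -- the Tian part.
  obtain ⟨L, hL, hLs⟩ := IsModularLattice.exists_disjoint_and_sup_eq
    (sup_le (sup_le k01 k02) k12 : K₀₁ ⊔ K₀₂ ⊔ K₁₂ ≤ Z)
  obtain ⟨L₀₁, hL₀₁, hLs₀₁⟩ := IsModularLattice.exists_disjoint_and_sup_eq
    (inf_le_left : K₀₁ ⊓ (K₀₂ ⊔ K₁₂) ≤ K₀₁)
  obtain ⟨L₀₂, hL₀₂, hLs₀₂⟩ := IsModularLattice.exists_disjoint_and_sup_eq
    (inf_le_left : K₀₂ ⊓ (K₀₁ ⊔ K₁₂) ≤ K₀₂)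
  obtain ⟨L₁₂, hL₁₂, hLs₁₂⟩ := IsModularLattice.exists_disjoint_and_sup_eq
    (inf_le_left : K₁₂ ⊓ (K₀₁ ⊔ K₀₂) ≤ K₁₂)
  obtain ⟨E, hE, hEs⟩ := IsModularLattice.exists_disjoint_and_sup_eq hDQ
  have l01 : L₀₁ ≤ K₀₁ := le_sup_right.trans hLs₀₁.le
  have l02 : L₀₂ ≤ K₀₂ := le_sup_right.trans hLs₀₂.le
  have l12 : L₁₂ ≤ K₁₂ := le_sup_right.trans hLs₁₂.le
  have lZ : L ≤ Z := le_sup_right.trans hLs.le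
  have eQ : E ≤ K₀₁ ⊓ (K₀₂ ⊔ K₁₂) := le_sup_right.trans hEs.le
  -- Writing `e = (e - g e) + g e` with summands in `K₀₂` and `K₁₂` forces `e` and `g e` to have the
  -- same component in `W 1`. Hence the range of `g` is the `B`-`C` half of the Tian part, glued to
  -- `E` along `B`.
  obtain ⟨g, hg⟩ := exists_linear_summand (eQ.trans inf_le_right)
  have e01 : ∀ e : E, (e : U) ∈ K₀₁ := fun e => (eQ e.2).1
  have e2 : ∀ e : E, p 2 (e : U) = 0 := fun e => ((m01 _).1 (e01 e)).2
  have g0 : ∀ e : E, p 0 (g e) = 0 := fun e => ((m12 _).1 (hg e).1).2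
  have g1 : ∀ e : E, p 1 (g e) = p 1 (e : U) := fun e => by
    have := ((m02 _).1 (hg e).2).2
    rw [map_sub] at this
    exact (sub_eq_zero.1 this).symm
  -- Independence of the parts in `W 0`: a vanishing `W 0`-component puts the sum in `K₁₂`. After
  -- the complements are removed, `d + e` lies in `K₀₁ ⊓ K₁₂ = D₁`, so `e ∈ D₀ ⊔ D₁` is zero.
  have key0 : ∀ d ∈ D₀, ∀ e : E, ∀ a ∈ L₀₁, ∀ b ∈ L₀₂, ∀ l ∈ L,
      d + p 0 (e : U) + p 0 a + p 0 b + p 0 l = 0 →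
      d = 0 ∧ (e : U) = 0 ∧ a = 0 ∧ b = 0 ∧ l = 0 := by
    intro d hd e a ha b hb l hl h
    have hz : (d + (e : U)) + a + b + l ∈ K₁₂ := by
      refine (m12 _).2 ⟨add_mem (add_mem (add_mem (add_mem hd.1 (k01 (e01 e))) (k01 (l01 ha)))
        (k02 (l02 hb))) (lZ hl), ?_⟩
      simpa only [map_add, pid 0 d hd.2] using h
    obtain ⟨rfl, rfl, rfl⟩ := eq_zero_of_add_mem hL₀₁ hL₀₂ hL l01 l02
      (add_mem (le_sup_left (b := K₁₂) (d002 hd)) (eQ e.2).2)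
      (le_sup_left (b := K₁₂) (add_mem (d001 hd) (e01 e))) ha hb hl hz
    simp only [add_zero] at hz
    have h1 : d + (e : U) ∈ D₁ := (m1 _).2
      ⟨k12 hz, ((m12 _).1 hz).2, ((m01 _).1 (add_mem (d001 hd) (e01 e))).2⟩
    have h2 : (e : U) = 0 := by
      refine disjoint_def.1 hE _ ?_ e.2
      rw [show (e : U) = -d + (d + e) by abel]
      exact add_mem_sup (neg_mem hd) h1
    refine ⟨?_, h2, rfl, rfl, rfl⟩
    simpa [h2] using h
  have key1 : ∀ d ∈ D₁, ∀ e : E, ∀ a ∈ L₀₁, ∀ b ∈ L₁₂, ∀ l ∈ L,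
      d + p 1 (e : U) + p 1 a + p 1 b + p 1 l = 0 →
      d = 0 ∧ (e : U) = 0 ∧ a = 0 ∧ b = 0 ∧ l = 0 := by
    intro d hd e a ha b hb l hl h
    have hz : (d + (e : U)) + a + b + l ∈ K₀₂ := by
      refine (m02 _).2 ⟨add_mem (add_mem (add_mem (add_mem hd.1 (k01 (e01 e))) (k01 (l01 ha)))
        (k12 (l12 hb))) (lZ hl), ?_⟩
      simpa only [map_add, pid 1 d hd.2] using h
    obtain ⟨rfl, rfl, rfl⟩ := eq_zero_of_add_mem (sup_comm K₀₂ K₁₂ ▸ hL₀₁) hL₁₂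
      (sup_right_comm K₀₁ K₀₂ K₁₂ ▸ hL) l01 l12
      (add_mem (le_sup_left (b := K₀₂) (d112 hd)) (sup_comm K₀₂ K₁₂ ▸ (eQ e.2).2))
      (le_sup_left (b := K₀₂) (add_mem (d101 hd) (e01 e))) ha hb hl hz
    simp only [add_zero] at hz
    have h1 : d + (e : U) ∈ D₀ := (m0 _).2
      ⟨k02 hz, ((m02 _).1 hz).2, ((m01 _).1 (add_mem (d101 hd) (e01 e))).2⟩
    have h2 : (e : U) = 0 := by
      refine disjoint_def.1 hE _ ?_ e.2
      rw [show (e : U) = (d + e) + -d by abel]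
      exact add_mem_sup h1 (neg_mem hd)
    refine ⟨?_, h2, rfl, rfl, rfl⟩
    simpa [h2] using h
  have key2 : ∀ d ∈ D₂, ∀ e : E, ∀ a ∈ L₀₂, ∀ b ∈ L₁₂, ∀ l ∈ L,
      d + p 2 (g e) + p 2 a + p 2 b + p 2 l = 0 →
      d = 0 ∧ (e : U) = 0 ∧ a = 0 ∧ b = 0 ∧ l = 0 := by
    intro d hd e a ha b hb l hl h
    have hz : (d + g e) + a + b + l ∈ K₀₁ := by
      refine (m01 _).2 ⟨add_mem (add_mem (add_mem (add_mem hd.1 (k12 (hg e).1)) (k02 (l02 ha)))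
        (k12 (l12 hb))) (lZ hl), ?_⟩
      simpa only [map_add, pid 2 d hd.2] using h
    have hge : g e ∈ K₀₂ ⊔ K₀₁ := by
      rw [show g e = -((e : U) - g e) + e by abel]
      exact add_mem_sup (neg_mem (hg e).2) (e01 e)
    obtain ⟨rfl, rfl, rfl⟩ := eq_zero_of_add_mem (sup_comm K₀₁ K₁₂ ▸ hL₀₂)
      (sup_comm K₀₁ K₀₂ ▸ hL₁₂)
      (show Disjoint (K₀₂ ⊔ K₁₂ ⊔ K₀₁) L by
        rwa [sup_comm (K₀₂ ⊔ K₁₂), ← sup_assoc]) l02 l12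
      (le_sup_left (b := K₀₁) (add_mem (d212 hd) (hg e).1))
      (add_mem (le_sup_left (b := K₀₁) (d202 hd)) hge) ha hb hl hz
    simp only [add_zero] at hz
    have h0 : p 0 (d + g e) = 0 := ((m12 _).1 (add_mem (d212 hd) (hg e).1)).2
    have h1 : d + g e ∈ D₁ := (m1 _).2 ⟨k01 hz, h0, ((m01 _).1 hz).2⟩
    -- `e` and `d + g e` have the same component in `W 1`, and neither has one in `W 2`.
    have h2 : (e : U) - (d + g e) ∈ D₀ := by
      refine (m0 _).2 ⟨sub_mem (k01 (e01 e)) h1.1, ?_, ?_⟩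
      · rw [map_sub, map_add, g1, ((m2 d).1 hd).2.2, zero_add, sub_self]
      · rw [map_sub, e2, ((m1 _).1 h1).2.2, sub_zero]
    have h3 : (e : U) = 0 := by
      refine disjoint_def.1 hE _ ?_ e.2
      rw [show (e : U) = (e - (d + g e)) + (d + g e) by abel]
      exact add_mem_sup h2 h1
    refine ⟨?_, h3, rfl, rfl, rfl⟩
    have h4 : g e = 0 := by
      rw [show e = 0 from Subtype.ext h3, map_zero]
    simpa [h4] using h
  have z0 := zero_mem D₀
  have z1 := zero_mem D₁
  have z2 := zero_mem D₂
  have inj01 : Function.Injective (p 0 ∘ₗ E.subtype) := injective_of_forall_eq_zero fun x hx =>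
    (key0 0 z0 x 0 (zero_mem _) 0 (zero_mem _) 0 (zero_mem _) (by simpa using hx)).2.1
  have inj02 : Function.Injective (p 0 ∘ₗ L₀₁.subtype) := injective_of_forall_eq_zero fun x hx =>
    (key0 0 z0 0 x x.2 0 (zero_mem _) 0 (zero_mem _) (by simpa using hx)).2.2.1
  have inj03 : Function.Injective (p 0 ∘ₗ L₀₂.subtype) := injective_of_forall_eq_zero fun x hx =>
    (key0 0 z0 0 0 (zero_mem _) x x.2 0 (zero_mem _) (by simpa using hx)).2.2.2.1
  have inj04 : Function.Injective (p 0 ∘ₗ L.subtype) := injective_of_forall_eq_zero fun x hx =>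
    (key0 0 z0 0 0 (zero_mem _) 0 (zero_mem _) x x.2 (by simpa using hx)).2.2.2.2
  have inj11 : Function.Injective (p 1 ∘ₗ E.subtype) := injective_of_forall_eq_zero fun x hx =>
    (key1 0 z1 x 0 (zero_mem _) 0 (zero_mem _) 0 (zero_mem _) (by simpa using hx)).2.1
  have inj12 : Function.Injective (p 1 ∘ₗ L₀₁.subtype) := injective_of_forall_eq_zero fun x hx =>
    (key1 0 z1 0 x x.2 0 (zero_mem _) 0 (zero_mem _) (by simpa using hx)).2.2.1
  have inj13 : Function.Injective (p 1 ∘ₗ L₁₂.subtype) := injective_of_forall_eq_zero fun x hx =>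
    (key1 0 z1 0 0 (zero_mem _) x x.2 0 (zero_mem _) (by simpa using hx)).2.2.2.1
  have inj14 : Function.Injective (p 1 ∘ₗ L.subtype) := injective_of_forall_eq_zero fun x hx =>
    (key1 0 z1 0 0 (zero_mem _) 0 (zero_mem _) x x.2 (by simpa using hx)).2.2.2.2
  have inj21 : Function.Injective (p 2 ∘ₗ g) := injective_of_forall_eq_zero fun x hx =>
    (key2 0 z2 x 0 (zero_mem _) 0 (zero_mem _) 0 (zero_mem _) (by simpa using hx)).2.1
  have inj22 : Function.Injective (p 2 ∘ₗ L₀₂.subtype) := injective_of_forall_eq_zero fun x hx =>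
    (key2 0 z2 0 x x.2 0 (zero_mem _) 0 (zero_mem _) (by simpa using hx)).2.2.1
  have inj23 : Function.Injective (p 2 ∘ₗ L₁₂.subtype) := injective_of_forall_eq_zero fun x hx =>
    (key2 0 z2 0 0 (zero_mem _) x x.2 0 (zero_mem _) (by simpa using hx)).2.2.2.1
  have inj24 : Function.Injective (p 2 ∘ₗ L.subtype) := injective_of_forall_eq_zero fun x hx =>
    (key2 0 z2 0 0 (zero_mem _) 0 (zero_mem _) x x.2 (by simpa using hx)).2.2.2.2
  let P : Fin 3 → Fin 5 → Submodule 𝕜 U :=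
    ![![D₀, LinearMap.range (p 0 ∘ₗ E.subtype), LinearMap.range (p 0 ∘ₗ L₀₁.subtype),
        LinearMap.range (p 0 ∘ₗ L₀₂.subtype), LinearMap.range (p 0 ∘ₗ L.subtype)],
      ![D₁, LinearMap.range (p 1 ∘ₗ E.subtype), LinearMap.range (p 1 ∘ₗ L₀₁.subtype),
        LinearMap.range (p 1 ∘ₗ L₁₂.subtype), LinearMap.range (p 1 ∘ₗ L.subtype)],
      ![D₂, LinearMap.range (p 2 ∘ₗ g), LinearMap.range (p 2 ∘ₗ L₀₂.subtype),
        LinearMap.range (p 2 ∘ₗ L₁₂.subtype), LinearMap.range (p 2 ∘ₗ L.subtype)]]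
  have Pind : ∀ i, iSupIndep (P i) := by
    intro i
    refine iSupIndep_fin_five ?_
    fin_cases i
    · rintro d hd _ ⟨e, rfl⟩ _ ⟨a, rfl⟩ _ ⟨b, rfl⟩ _ ⟨l, rfl⟩ h
      obtain ⟨h1, h2, h3, h4, h5⟩ := key0 d hd e a a.2 b b.2 l l.2 h
      simp [h1, h2, h3, h4, h5]
    · rintro d hd _ ⟨e, rfl⟩ _ ⟨a, rfl⟩ _ ⟨b, rfl⟩ _ ⟨l, rfl⟩ h
      obtain ⟨h1, h2, h3, h4, h5⟩ := key1 d hd e a a.2 b b.2 l l.2 h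
      simp [h1, h2, h3, h4, h5]
    · rintro d hd _ ⟨e, rfl⟩ _ ⟨a, rfl⟩ _ ⟨b, rfl⟩ _ ⟨l, rfl⟩ h
      obtain ⟨h1, h2, h3, h4, h5⟩ := key2 d hd e a a.2 b b.2 l l.2 h
      rw [show e = 0 from Subtype.ext h2]
      simp [h1, h3, h4, h5]
  have PW : ∀ i k, P i k ≤ W i := by
    have hr : ∀ i {M : Type _} [AddCommGroup M] [Module 𝕜 M] (f : M →ₗ[𝕜] U),
        LinearMap.range (p i ∘ₗ f) ≤ W i := by
      rintro i M _ _ f _ ⟨x, rfl⟩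
      exact pW i _
    intro i k
    fin_cases i <;> fin_cases k
    exacts [inf_le_right, hr 0 _, hr 0 _, hr 0 _, hr 0 _, inf_le_right, hr 1 _, hr 1 _, hr 1 _,
      hr 1 _, inf_le_right, hr 2 _, hr 2 _, hr 2 _, hr 2 _]
  have tAB : twoWaySum (rangeEquiv _ _ inj01 inj11) = E := by
    rw [twoWaySum_rangeEquiv, ← LinearMap.add_comp,
      show (p 0 + p 1) ∘ₗ E.subtype = E.subtype from LinearMap.ext fun e => ?_, range_subtype]
    have := sum' e (k01 (e01 e))
    rwa [e2, add_zero] at this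
  have tBC : twoWaySum (rangeEquiv _ _ inj11 inj21) = LinearMap.range g := by
    rw [twoWaySum_rangeEquiv,
      show p 1 ∘ₗ E.subtype + p 2 ∘ₗ g = g from LinearMap.ext fun e => ?_]
    have := sum' (g e) (k12 (hg e).1)
    rwa [g0, g1, zero_add] at this
  have wAB : twoWaySum (rangeEquiv _ _ inj02 inj12) = L₀₁ := by
    rw [twoWaySum_rangeEquiv, ← LinearMap.add_comp,
      show (p 0 + p 1) ∘ₗ L₀₁.subtype = L₀₁.subtype from LinearMap.ext fun e => ?_, range_subtype]
    have := sum' e (k01 (l01 e.2))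
    rwa [((m01 _).1 (l01 e.2)).2, add_zero] at this
  have wAC : twoWaySum (rangeEquiv _ _ inj03 inj22) = L₀₂ := by
    rw [twoWaySum_rangeEquiv, ← LinearMap.add_comp,
      show (p 0 + p 2) ∘ₗ L₀₂.subtype = L₀₂.subtype from LinearMap.ext fun e => ?_, range_subtype]
    have := sum' e (k02 (l02 e.2))
    rwa [((m02 _).1 (l02 e.2)).2, add_zero] at this
  have wBC : twoWaySum (rangeEquiv _ _ inj13 inj23) = L₁₂ := by
    rw [twoWaySum_rangeEquiv, ← LinearMap.add_comp,
      show (p 1 + p 2) ∘ₗ L₁₂.subtype = L₁₂.subtype from LinearMap.ext fun e => ?_, range_subtype]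
    have := sum' e (k12 (l12 e.2))
    rwa [((m12 _).1 (l12 e.2)).2, zero_add] at this
  have wABC : threeWaySum (rangeEquiv _ _ inj04 inj14) (rangeEquiv _ _ inj04 inj24) = L := by
    rw [threeWaySum_rangeEquiv, ← LinearMap.add_comp, ← LinearMap.add_comp,
      show (p 0 + p 1 + p 2) ∘ₗ L.subtype = L.subtype from LinearMap.ext fun e => ?_,
      range_subtype]
    exact sum' e (lZ e.2)
  have hsup : Z = (D₀ ⊔ D₁ ⊔ D₂) ⊔ (E ⊔ LinearMap.range g) ⊔ (L₀₁ ⊔ L₀₂ ⊔ L₁₂) ⊔ L := by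
    set T := (D₀ ⊔ D₁ ⊔ D₂) ⊔ (E ⊔ LinearMap.range g) ⊔ (L₀₁ ⊔ L₀₂ ⊔ L₁₂) ⊔ L with hT
    obtain ⟨⟨⟨⟨⟨t0, t1⟩, t2⟩, tE, tg⟩, ⟨t01, t02⟩, t12⟩, tL⟩ :
        (((((D₀ ≤ T) ∧ D₁ ≤ T) ∧ D₂ ≤ T) ∧ E ≤ T ∧ LinearMap.range g ≤ T) ∧
          ((L₀₁ ≤ T) ∧ L₀₂ ≤ T) ∧ L₁₂ ≤ T) ∧ L ≤ T := by
      simp only [← sup_le_iff]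
      exact hT.ge
    have tg' : ∀ e : E, g e ∈ T := fun e => tg ⟨e, rfl⟩
    have hQ : K₀₁ ⊓ (K₀₂ ⊔ K₁₂) ≤ T := hEs ▸ sup_le (sup_le t0 t1) tE
    have hQ' : ∀ z ∈ K₀₁ ⊓ (K₀₂ ⊔ K₁₂), ∃ a ∈ D₀, ∃ b ∈ D₁, ∃ e : E, a + b + (e : U) = z := by
      intro z hz
      rw [← hEs] at hz
      obtain ⟨s, hs, e, he, rfl⟩ := mem_sup.1 hz
      obtain ⟨a, ha, b, hb, rfl⟩ := mem_sup.1 hs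
      exact ⟨a, ha, b, hb, ⟨e, he⟩, rfl⟩
    -- Although `E` was chosen inside `K₀₁`, it serves the other two pairs as well: `u = a + b + e`
    -- gives `u + v = a + (e - g e) + (b + g e + v)`, and the last term lies in `K₀₂ ⊓ K₁₂ = D₂`.
    have hQ₀₂ : K₀₂ ⊓ (K₀₁ ⊔ K₁₂) ≤ T := by
      rintro z ⟨hz, hz'⟩
      obtain ⟨u, hu, v, hv, rfl⟩ := mem_sup.1 hz'
      obtain ⟨a, ha, b, hb, e, rfl⟩ := hQ' u ⟨hu, by
        rw [show u = (u + v) + -v by abel]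
        exact add_mem_sup hz (neg_mem hv)⟩
      have h1 : b + g e + v ∈ D₂ := by
        have h2 : b + g e + v ∈ K₁₂ := add_mem (add_mem (d112 hb) (hg e).1) hv
        have h3 : b + g e + v ∈ K₀₂ := by
          rw [show b + g e + v = (a + b + e + v) - a - (e - g e) by abel]
          exact sub_mem (sub_mem hz (d002 ha)) (hg e).2
        exact (m2 _).2 ⟨k12 h2, ((m12 _).1 h2).2, ((m02 _).1 h3).2⟩
      rw [show a + b + (e : U) + v = a + e - g e + (b + g e + v) by abel]
      exact add_mem (sub_mem (add_mem (t0 ha) (tE e.2)) (tg' e)) (t2 h1)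
    have hQ₁₂ : K₁₂ ⊓ (K₀₁ ⊔ K₀₂) ≤ T := by
      rintro z ⟨hz, hz'⟩
      obtain ⟨u, hu, v, hv, rfl⟩ := mem_sup.1 hz'
      obtain ⟨a, ha, b, hb, e, rfl⟩ := hQ' u ⟨hu, by
        rw [show u = -v + (u + v) by abel]
        exact add_mem_sup (neg_mem hv) hz⟩
      have h1 : a + (e - g e) + v ∈ D₂ := by
        have h2 : a + ((e : U) - g e) + v ∈ K₀₂ := add_mem (add_mem (d002 ha) (hg e).2) hv
        have h3 : a + ((e : U) - g e) + v ∈ K₁₂ := by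
          rw [show a + ((e : U) - g e) + v = (a + b + e + v) - b - g e by abel]
          exact sub_mem (sub_mem hz (d112 hb)) (hg e).1
        exact (m2 _).2 ⟨k12 h3, ((m12 _).1 h3).2, ((m02 _).1 h2).2⟩
      rw [show a + b + (e : U) + v = b + g e + (a + (e - g e) + v) by abel]
      exact add_mem (add_mem (t1 hb) (tg' e)) (t2 h1)
    refine le_antisymm ?_ ?_
    · refine hLs.ge.trans (sup_le (sup_le (sup_le ?_ ?_) ?_) tL)
      · exact hLs₀₁.ge.trans (sup_le hQ t01)
      · exact hLs₀₂.ge.trans (sup_le hQ₀₂ t02)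
      · exact hLs₁₂.ge.trans (sup_le hQ₁₂ t12)
    · refine sup_le (sup_le (sup_le (sup_le (sup_le inf_le_left inf_le_left) inf_le_left)
        (sup_le ((eQ.trans inf_le_left).trans k01) ?_))
        (sup_le (sup_le (l01.trans k01) (l02.trans k02)) (l12.trans k12))) lZ
      rintro _ ⟨e, rfl⟩
      exact k12 (hg e).1
  have hrk : ∀ {M : Submodule 𝕜 U} (f : M →ₗ[𝕜] U), Function.Injective f →
      rk (LinearMap.range f) = rk M := fun f hf => by
    unfold rk
    rw [LinearMap.finrank_range_of_inj hf]
  have hD : Disjoint D₀ D₁ := by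
    refine disjoint_def.2 fun x h0 h1 => ?_
    rw [← pid 0 x h0.2, ((m1 x).1 h1).2.1]
  refine ⟨⟨P, PW, Pind, rangeEquiv _ _ inj01 inj11, rangeEquiv _ _ inj11 inj21,
    rangeEquiv _ _ inj02 inj12, rangeEquiv _ _ inj03 inj22, rangeEquiv _ _ inj13 inj23,
    rangeEquiv _ _ inj04 inj14, rangeEquiv _ _ inj04 inj24, ?_⟩, ?_, ?_, ?_, ?_, ?_, ?_⟩
  · exact hsup.trans (congrArg₂ (· ⊔ ·) (congrArg₂ (· ⊔ ·)
      (congrArg₂ (· ⊔ ·) rfl (congrArg₂ (· ⊔ ·) tAB.symm tBC.symm))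
      (congrArg₂ (· ⊔ ·) (congrArg₂ (· ⊔ ·) wAB.symm wAC.symm) wBC.symm)) wABC.symm)
  · intro i
    fin_cases i <;> rfl
  · change rk (LinearMap.range (p 0 ∘ₗ E.subtype)) + _ + _ = _
    rw [hrk _ inj01, ← hEs, rk_sup_of_disjoint hE, rk_sup_of_disjoint hD]
    ring
  · change rk (LinearMap.range (p 0 ∘ₗ L₀₁.subtype)) + _ = _
    rw [hrk _ inj02, add_comm, ← rk_sup_of_disjoint hL₀₁, hLs₀₁]
  · change rk (LinearMap.range (p 0 ∘ₗ L₀₂.subtype)) + _ = _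
    rw [hrk _ inj03, add_comm, ← rk_sup_of_disjoint hL₀₂, hLs₀₂]
  · change rk (LinearMap.range (p 1 ∘ₗ L₁₂.subtype)) + _ = _
    rw [hrk _ inj13, add_comm, ← rk_sup_of_disjoint hL₁₂, hLs₁₂]
  · change rk (LinearMap.range (p 0 ∘ₗ L.subtype)) + _ = _
    rw [hrk _ inj04, add_comm, ← rk_sup_of_disjoint hL, hLs]

end

/-! ### Ratios of a symmetric scheme. -/

namespace LinearCachingScheme

open Submodule

variable {𝕜 U : Type*} [Field 𝕜] [AddCommGroup U] [Module 𝕜 U] {F : ℕ}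

/-- The dimensions that determine those of the parts of a cache are the same for all users and
all documents of a symmetric scheme. -/
theorem IsSymmetric.rk_eq {S : LinearCachingScheme 𝕜 U 3 3 F} (h : S.IsSymmetric)
    (κ ν : Equiv.Perm (Fin 3)) (j : Fin 3) :
    rk (S.Z (κ j)) = rk (S.Z j) ∧
    (∀ i, rk (S.Z (κ j) ⊓ S.W (ν i)) = rk (S.Z j ⊓ S.W i)) ∧
    (∀ a b, rk (S.Z (κ j) ⊓ (S.W (ν a) ⊔ S.W (ν b))) = rk (S.Z j ⊓ (S.W a ⊔ S.W b))) ∧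
    (∀ a b c d e f, rk ((S.Z (κ j) ⊓ (S.W (ν a) ⊔ S.W (ν b))) ⊓
        ((S.Z (κ j) ⊓ (S.W (ν c) ⊔ S.W (ν d))) ⊔ (S.Z (κ j) ⊓ (S.W (ν e) ⊔ S.W (ν f))))) =
      rk ((S.Z j ⊓ (S.W a ⊔ S.W b)) ⊓
        ((S.Z j ⊓ (S.W c ⊔ S.W d)) ⊔ (S.Z j ⊓ (S.W e ⊔ S.W f))))) ∧
    ∀ a b c d e f, rk ((S.Z (κ j) ⊓ (S.W (ν a) ⊔ S.W (ν b))) ⊔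
        (S.Z (κ j) ⊓ (S.W (ν c) ⊔ S.W (ν d))) ⊔ (S.Z (κ j) ⊓ (S.W (ν e) ⊔ S.W (ν f)))) =
      rk ((S.Z j ⊓ (S.W a ⊔ S.W b)) ⊔
        (S.Z j ⊓ (S.W c ⊔ S.W d)) ⊔ (S.Z j ⊓ (S.W e ⊔ S.W f))) := by
  obtain ⟨e, hW, hZ, -⟩ := h κ ν
  have hi : ∀ p q : Submodule 𝕜 U,
      (p ⊓ q).map e.toLinearMap = p.map e.toLinearMap ⊓ q.map e.toLinearMap :=
    fun p q => Submodule.map_inf _ e.injective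
  have hs : ∀ p q : Submodule 𝕜 U,
      (p ⊔ q).map e.toLinearMap = p.map e.toLinearMap ⊔ q.map e.toLinearMap :=
    fun p q => Submodule.map_sup _ _ _
  simp only [← hW, ← hZ, ← hi, ← hs, rk_map_equiv, implies_true, and_self]

theorem exists_perm_apply_eq (a b : Fin 3) : ∃ κ : Equiv.Perm (Fin 3), κ a = b :=
  ⟨Equiv.swap a b, Equiv.swap_apply_left a b⟩

/-- The decompositions of the three caches are chosen independently. Only their dimensions have to
agree, and `exists_cacheDecomposition` expresses these through intersections and sums of `Z j` and
`W i`, which the automorphisms permute. -/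
theorem exists_hasRatios [FiniteDimensional 𝕜 U] (hF : 0 < F) {S : LinearCachingScheme 𝕜 U 3 3 F}
    (hS : S.IsSymmetric) (hZ : ∀ j, S.Z j ≤ ⨆ i, S.W i) :
    ∃ r₁ r₂ r₃ r₄ r₅ : ℝ, S.HasRatios r₁ r₂ r₃ r₄ r₅ := by
  have hZ' : ∀ j, S.Z j ≤ S.W 0 ⊔ S.W 1 ⊔ S.W 2 := by
    refine fun j => (hZ j).trans (iSup_le fun i => ?_)
    fin_cases i
    exacts [le_sup_left.trans le_sup_left, le_sup_right.trans le_sup_left, le_sup_right]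
  choose D hD using fun j => exists_cacheDecomposition S.indep (hZ' j) rfl rfl rfl
  have hF' : (F : ℝ) ≠ 0 := Nat.cast_ne_zero.2 hF.ne'
  have eqv : ∀ {A B : Submodule 𝕜 U}, (A ≃ₗ[𝕜] B) → rk B = rk A := fun e => by
    unfold rk
    rw [e.finrank_eq]
  have sw12 : Equiv.swap (1 : Fin 3) 2 0 = 0 := by decide
  have sw02 : Equiv.swap (0 : Fin 3) 2 1 = 1 := by decide
  have c0 : ∀ j i, rk ((D j).P i 0) = rk ((D 0).P 0 0) := by
    intro j i
    obtain ⟨κ, rfl⟩ := exists_perm_apply_eq 0 j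
    obtain ⟨ν, rfl⟩ := exists_perm_apply_eq 0 i
    rw [(hD _).1, (hD _).1, (hS.rk_eq κ ν 0).2.1]
  have c1 : ∀ j, rk ((D j).P 0 1) = rk ((D 0).P 0 1) := by
    intro j
    obtain ⟨κ, rfl⟩ := exists_perm_apply_eq 0 j
    have h1 := (hD (κ 0)).2.1
    have h2 := (hD 0).2.1
    have s := hS.rk_eq κ 1 0
    simp only [Equiv.Perm.coe_one, id_eq] at s
    rw [s.2.1, s.2.1, s.2.2.2.1] at h1
    linarith
  have c1' : ∀ j i, rk ((D j).P i 1) = rk ((D 0).P 0 1) := by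
    intro j i
    fin_cases i
    · exact c1 j
    · exact (eqv (D j).tianAB).trans (c1 j)
    · exact ((eqv (D j).tianBC).trans (eqv (D j).tianAB)).trans (c1 j)
  have c4 : ∀ j, rk ((D j).P 0 4) = rk ((D 0).P 0 4) := by
    intro j
    obtain ⟨κ, rfl⟩ := exists_perm_apply_eq 0 j
    have h1 := (hD (κ 0)).2.2.2.2.2
    have h2 := (hD 0).2.2.2.2.2
    have s := hS.rk_eq κ 1 0
    simp only [Equiv.Perm.coe_one, id_eq] at s
    rw [s.1, s.2.2.2.2] at h1
    linarith
  have c4' : ∀ j i, rk ((D j).P i 4) = rk ((D 0).P 0 4) := by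
    intro j i
    fin_cases i
    · exact c4 j
    · exact (eqv (D j).tripleAB).trans (c4 j)
    · exact (eqv (D j).tripleAC).trans (c4 j)
  have c2 : ∀ j, rk ((D j).P 0 2) = rk ((D 0).P 0 2) := by
    intro j
    obtain ⟨κ, rfl⟩ := exists_perm_apply_eq 0 j
    have h1 := (hD (κ 0)).2.2.1
    have h2 := (hD 0).2.2.1
    have s := hS.rk_eq κ 1 0
    simp only [Equiv.Perm.coe_one, id_eq] at s
    rw [s.2.2.1, s.2.2.2.1] at h1
    linarith
  have c3 : ∀ j, rk ((D j).P 0 3) = rk ((D 0).P 0 2) := by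
    intro j
    obtain ⟨κ, rfl⟩ := exists_perm_apply_eq 0 j
    have h1 := (hD (κ 0)).2.2.2.1
    have h2 := (hD 0).2.2.1
    -- Swapping documents 1 and 2 carries the `AB`-part to the `AC`-part.
    have s := hS.rk_eq κ (Equiv.swap 1 2) 0
    have s1 := s.2.2.1 0 1
    have s2 := s.2.2.2.1 0 1 0 2 1 2
    simp only [sw12, Equiv.swap_apply_left, Equiv.swap_apply_right] at s1 s2
    rw [sup_comm (S.W 2) (S.W 1)] at s2
    linarith
  have c3' : ∀ j, rk ((D j).P 1 3) = rk ((D 0).P 0 2) := by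
    intro j
    obtain ⟨κ, rfl⟩ := exists_perm_apply_eq 0 j
    have h1 := (hD (κ 0)).2.2.2.2.1
    have h2 := (hD 0).2.2.1
    -- Swapping documents 0 and 2 carries the `AB`-part to the `BC`-part, as far as dimensions are
    -- concerned.
    have s := hS.rk_eq κ (Equiv.swap 0 2) 0
    have s1 := s.2.2.1 1 0
    have s2 := s.2.2.2.1 1 0 1 2 0 2
    simp only [sw02, Equiv.swap_apply_left, Equiv.swap_apply_right, sup_comm (S.W 1) (S.W 0),
      sup_comm (S.W 2) (S.W 0)] at s1 s2
    rw [sup_comm (S.Z 0 ⊓ (S.W 1 ⊔ S.W 2))] at s2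
    linarith
  have c2' : ∀ j i, rk ((D j).P i 2) = rk ((D 0).P 0 2) ∧ rk ((D j).P i 3) = rk ((D 0).P 0 2) := by
    intro j i
    fin_cases i
    · exact ⟨c2 j, c3 j⟩
    · exact ⟨(eqv (D j).pairAB).trans (c2 j), c3' j⟩
    · exact ⟨(eqv (D j).pairAC).trans (c3 j), (eqv (D j).pairBC).trans (c3' j)⟩
  have c5 : ∀ j i, rk ((D j).P i 2 ⊔ (D j).P i 3) = 2 * rk ((D 0).P 0 2) := by
    intro j i
    rw [rk_sup_of_disjoint (((D j).indep i).pairwiseDisjoint (by decide)), (c2' j i).1,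
      (c2' j i).2]
    ring
  refine ⟨rk ((D 0).P 0 0) / F, rk ((D 0).P 0 1) / F, 2 * rk ((D 0).P 0 2) / F,
    rk ((D 0).P 0 4) / F, (F - rk (⨆ j, ⨆ k, (D j).P 0 k)) / (3 * F), D, fun j i => ?_,
    fun j i => ?_, ⟨Module.finrank 𝕜 ((D 0).P 0 2), fun j i => ⟨?_, ?_⟩⟩, fun j i => ?_,
    fun j i => ?_, ?_⟩
  · rw [mul_div_cancel₀ _ hF']
    exact (c0 j i).symm
  · rw [mul_div_cancel₀ _ hF']
    exact (c1' j i).symm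
  · exact Nat.cast_injective (R := ℝ) (c2' j i).1
  · exact Nat.cast_injective (R := ℝ) (c2' j i).2
  · rw [mul_div_cancel₀ _ hF']
    exact (c5 j i).symm
  · rw [mul_div_cancel₀ _ hF']
    exact (c4' j i).symm
  · rw [mul_div_cancel₀ _ (by positivity)]
    rfl

end LinearCachingScheme

theorem mainTheorem1 {𝕜 U : Type*} [Field 𝕜] [AddCommGroup U] [Module 𝕜 U]
    [FiniteDimensional 𝕜 U] {F : ℕ} (hF : 0 < F) (S : LinearCachingScheme 𝕜 U 3 3 F)
    (M R : ℝ) (hMR : S.Achieves M R) :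
    11 ≤ 6 * M + 5 * R ∧
    (S.IsSymmetric →
      ((∀ j, S.Z j ≤ ⨆ i, S.W i) → ∃ r₁ r₂ r₃ r₄ r₅ : ℝ, S.HasRatios r₁ r₂ r₃ r₄ r₅) ∧
      ∀ r₁ r₂ r₃ r₄ r₅ : ℝ, S.HasRatios r₁ r₂ r₃ r₄ r₅ →
        11 + 15 / 2 * r₅ ≤ 6 * M + 5 * R) :=
  ⟨S.eleven_le hF hMR, fun hS => ⟨LinearCachingScheme.exists_hasRatios hF hS,
    fun _ _ _ _ _ hr => LinearCachingScheme.le_of_hasRatios hF hS hMR hr⟩⟩
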